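/- **Definitions.** Let $n,m\ge 1$ and $s=n+m$. A cut-and-project scheme $\Lambda=(\mathcal L\subset\mathbb R^s,\mathbb R^n)$ is given by a lattice $\mathcal L=\mathrm{span}_{\mathbb Z}\{\boldsymbol l_1,\dots,\boldsymbol l_s\}$, where $\boldsymbol l_1,\dots,\boldsymbol l_s$ is a basis of $\mathbb R^s$; $s$ is called the dimension of the lattice. Let $\pi_\parallel:\mathbb R^s\to\mathbb R^n$ and $\pi_\perp:\mathbb R^s\to\mathbb R^{m}$ be the projections to the first $n$ and to the last $m=s-n$ coordinates. The scheme is generic if $\pi_\parallel|_{\mathcal L}$ and $\pi_\perp|_{\mathcal L}$ are injective and $\pi_\perp(\mathcal L)$ is dense in $\mathbb R^{s-n}$. A window is a bounded set $\Omega\subset\mathbb R^{s-n}$ with $\overline{\Omega^\circ}=\overline{\Omega}\ne\emptyset$. The cut-and-project set of a generic scheme with window $\Omega$ is $\Sigma(\Omega)=\{\pi_\parallel(\boldsymbol l):\boldsymbol l\in\mathcal L,\ \pi_\perp(\boldsymbol l)\in\Omega\}$. A matrix $A\in\mathbb R^{n\times n}$ is a self-similarity of $\Sigma(\Omega)$ if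 $A\Sigma(\Omega)\subset\Sigma(\Omega)$. For $\lambda\in\mathbb C$ let $m_A(\lambda)\ge 0$ be its algebraic multiplicity as an eigenvalue of $A$ ($0$ if it is not an eigenvalue). Write $\mu\sim\nu$ if the algebraic numbers $\mu,\nu\in\mathbb C$ have the same minimal polynomial over $\mathbb Q$. The matrix $A$ has property $\mathfrak P$ if * ($\mathfrak P1$) every eigenvalue of $A$ is an algebraic integer; * ($\mathfrak P2$) every $\mu\in\mathbb C$ with $|\mu|>1$ such that $\mu\sim\lambda$ for some eigenvalue $\lambda$ of $A$ is itself an eigenvalue of $A$, and $m_A(\mu)\ge m_A(\nu)$ for all $\nu\sim\mu$, with strict inequality for at least one $\nu\sim\mu$. **Theorem.** Let $n\ge1$ and let $A\in\mathbb R^{n\times n}$ be non-singular, diagonalizable over $\mathbb C$, and have property $\mathfrak P$. Then the minimal polynomial $\mu_{A,\mathbb Q}$ of $A$ over $\mathbb Q$ (the monic polynomial of least degree in $\mathbb Q[X]$ that annihilates $A$) factors as $\mu_{A,\mathbb Q}=f_1\cdots f_k$ with distinct monic polynomials $f_i\in\mathbb Z[X]$ irreducible over $\mathbb Q$. For any such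 factorization let $d_i=\deg f_i$, let $M_i$ and $m_i$ be the maximum and the minimum of $m_A(\lambda)$ over all complex roots $\lambda$ of $f_i$, and set $$s_i=\begin{cases}M_id_i & \text{if } f_i \text{ is not a cyclotomic polynomial},\\ M_id_i & \text{if } f_i \text{ is a cyclotomic polynomial and } M_i>m_i,\\ (M_i+1)d_i & \text{if } f_i \text{ is a cyclotomic polynomial and } M_i=m_i.\end{cases}$$ Then $s=s_1+\cdots+s_k$ is the smallest dimension of a lattice for which there exist a generic cut-and-project scheme $\Lambda=(\mathcal L\subset\mathbb R^s,\mathbb R^n)$ and a cut-and-project set $\Sigma(\Omega)$ of $\Lambda$ with $A\Sigma(\Omega)\subset\Sigma(\Omega)$. -/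

import Mathlib

namespace CutProject

noncomputable section

/-! ### Cut-and-project schemes and sets -/

/-- The projection of `ℝ^(n+m)` onto the physical space: the first `n` coordinates. -/
def physProj (n m : ℕ) (x : Fin (n + m) → ℝ) : Fin n → ℝ :=
  fun i => x (Fin.castAdd m i)

/-- The projection of `ℝ^(n+m)` onto the internal space: the last `m` coordinates. -/
def intProj (n m : ℕ) (x : Fin (n + m) → ℝ) : Fin m → ℝ :=
  fun j => x (Fin.natAdd n j)

/-- A cut-and-project scheme with physical space `ℝ^n` and internal space `ℝ^m`, both of
dimension at least one: a lattice of full rank in `ℝ^s`, where `s = n + m`. -/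
structure Scheme (n m : ℕ) where
  phys_pos : 1 ≤ n
  int_pos : 1 ≤ m
  lattice : Submodule ℤ (Fin (n + m) → ℝ)
  exists_basis : ∃ b : Module.Basis (Fin (n + m)) ℝ (Fin (n + m) → ℝ),
    lattice = Submodule.span ℤ (Set.range b)

namespace Scheme

variable {n m : ℕ} (S : Scheme n m)

def NonDegenerate : Prop := Set.InjOn (physProj n m) (S.lattice : Set (Fin (n + m) → ℝ))

def Aperiodic : Prop := Set.InjOn (intProj n m) (S.lattice : Set (Fin (n + m) → ℝ))

/-- "Irreducible" in the sense of schemes: the internal projection of the lattice is dense. -/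
def IsIrreducible : Prop := Dense (intProj n m '' (S.lattice : Set (Fin (n + m) → ℝ)))

def Generic : Prop := S.NonDegenerate ∧ S.Aperiodic ∧ S.IsIrreducible

/-- The cut-and-project set `Σ(Ω)` of the scheme with acceptance window `Ω`. -/
def cutSet (W : Set (Fin m → ℝ)) : Set (Fin n → ℝ) :=
  {y | ∃ l ∈ S.lattice, intProj n m l ∈ W ∧ physProj n m l = y}

end Scheme

/-- Acceptance windows: bounded sets whose closure is nonempty and equal to the closure of the
interior. -/
def IsWindow {m : ℕ} (W : Set (Fin m → ℝ)) : Prop :=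
  Bornology.IsBounded W ∧ closure (interior W) = closure W ∧ (closure W).Nonempty

/-- There are a generic cut-and-project scheme given by a lattice of dimension `s` and a
cut-and-project set of that scheme which the linear map `A` maps into itself. -/
def AdmitsSelfSimilarSet {n : ℕ} (A : Matrix (Fin n) (Fin n) ℝ) (s : ℕ) : Prop :=
  ∃ m : ℕ, s = n + m ∧ ∃ S : Scheme n m, S.Generic ∧
    ∃ W : Set (Fin m → ℝ), IsWindow W ∧
      Set.MapsTo (fun x => A.mulVec x) (S.cutSet W) (S.cutSet W)

/-! ### Spectral data of a real matrix -/

variable {n : ℕ} (A : Matrix (Fin n) (Fin n) ℝ)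

/-- The matrix `A` regarded as a complex matrix. -/
def complexify : Matrix (Fin n) (Fin n) ℂ := A.map (algebraMap ℝ ℂ)

/-- `A` is diagonalizable over `ℂ`. -/
def DiagonalizableOverC : Prop :=
  ∃ (P : Matrix (Fin n) (Fin n) ℂ) (v : Fin n → ℂ),
    IsUnit P ∧ complexify A * P = P * Matrix.diagonal v

/-- The algebraic multiplicity of `z` as an eigenvalue of `A` (zero if `z` is no eigenvalue). -/
def mult (z : ℂ) : ℕ := (complexify A).charpoly.rootMultiplicity z

/-- `a` is an algebraic number and `b` is a root of its minimal polynomial over `ℚ`. -/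
def AlgConj (a b : ℂ) : Prop := IsAlgebraic ℚ a ∧ IsConjRoot ℚ a b

/-- The eigenvalues of `A` are algebraic integers. -/
def PropertyP1 : Prop := ∀ z ∈ spectrum ℂ (complexify A), IsIntegral ℤ z

/-- Every `w` with `|w| > 1` that is conjugate to an eigenvalue of `A` is an eigenvalue of `A`;
its multiplicity is maximal among its conjugates, and not all of these have that multiplicity. -/
def PropertyP2 : Prop :=
  ∀ w : ℂ, 1 < ‖w‖ → (∃ z ∈ spectrum ℂ (complexify A), AlgConj z w) →
    w ∈ spectrum ℂ (complexify A) ∧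
    (∀ u : ℂ, AlgConj w u → mult A u ≤ mult A w) ∧
    ∃ u : ℂ, AlgConj w u ∧ mult A u < mult A w

def PropertyP : Prop := PropertyP1 A ∧ PropertyP2 A

/-! ### The dimension attached to an irreducible factor -/

open Polynomial

/-- The largest multiplicity in `A` of a complex root of `f`. -/
def maxMult (f : ℤ[X]) : ℕ := sSup (mult A '' f.rootSet ℂ)

/-- The smallest multiplicity in `A` of a complex root of `f`. -/
def minMult (f : ℤ[X]) : ℕ := sInf (mult A '' f.rootSet ℂ)

def IsCyclotomicPoly (f : ℤ[X]) : Prop := ∃ r : ℕ, 0 < r ∧ f = cyclotomic r ℤ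

open Classical in
/-- The dimension `s_i` attached to the irreducible factor `f = f_i`. -/
def factorDim (f : ℤ[X]) : ℕ :=
  if IsCyclotomicPoly f then
    if minMult A f < maxMult A f then maxMult A f * f.natDegree
    else (maxMult A f + 1) * f.natDegree
  else maxMult A f * f.natDegree

/-- `f 0, …, f (k-1)` are distinct monic integer polynomials, irreducible over `ℚ`, whose
product is the minimal polynomial of `A` over `ℚ`. -/
def IsMinpolyFactorization {k : ℕ} (f : Fin k → ℤ[X]) : Prop :=
  Function.Injective f ∧ (∀ i, (f i).Monic) ∧
    (∀ i, Irreducible ((f i).map (Int.castRingHom ℚ))) ∧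
    minpoly ℚ A = ∏ i, (f i).map (Int.castRingHom ℚ)

end

end CutProject

namespace CutProject

open Filter Topology

/-! ### Density of subgroups of finite-dimensional spaces -/

/-! Existence. The lattice consists of `N i` copies of `ℤ[X]/(f i)` for each factor, where `N i *
d_i = s_i`. Its vectors are encoded by their values at the complex roots: the value number `a` at
the root `z` is physical if `a < mult A z` and internal otherwise. An eigenbasis of `A` compatible
with complex conjugation turns the physical values into `ℝ^n` and multiplication by `X` into `A`
(`IsModelData.exists_physical_map`). A root carries an internal value only if its multiplicity is
below `N i`; by `𝔓2` such a root has modulus at most one, so bounding the internal values by one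
gives a window that multiplication by `X` preserves.

Each factor must own an internal value. If `f i` is not cyclotomic, Kronecker's theorem yields a
root outside the unit disc (`f i = X` is excluded by non-singularity), and `𝔓2` yields a conjugate
of smaller multiplicity. A cyclotomic factor with constant multiplicity needs one more copy
(`isModelData_of_propertyP`). A single copy could still be wholly physical, so the copies are mixed
by an orthogonal matrix with rows independent over the algebraic numbers. Then one vanishing value
kills the whole block of an integral vector, which makes both projections injective. The same
independence shows that no nonzero functional is integral on the internal projection, which is
therefore dense.

Minimality. Density of the internal projection extends a self-similarity to a linear map `B`
preserving the lattice, and boundedness of the window makes `B` respect both projections, acting as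
`A` and as some `D`. So `χ = A.charpoly * D.charpoly` is integral of degree `s`, and an integral
polynomial that annihilates `D` annihilates `A`, by aperiodicity (`exists_charpoly_factorization`).
All roots of `f i` have equal multiplicity in `χ`, at least the maximal one in `A`. If it equals a
constant multiplicity in `A`, the roots do not occur in `D`, so removing `f i` from `χ` still
annihilates `D` and hence `A`, which is absurd (`pow_factorCopies_dvd`). -/

/-- A closed subgroup of a finite-dimensional space that contains no line is discrete. -/
theorem discreteTopology_of_no_line {W : Type*} [NormedAddCommGroup W] [NormedSpace ℝ W]
    [FiniteDimensional ℝ W] (K : AddSubgroup W) (hK : IsClosed (K : Set W))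
    (hline : ∀ u : W, (∀ t : ℝ, t • u ∈ K) → u = 0) : DiscreteTopology K := by
  have : ProperSpace W := FiniteDimensional.proper_real W
  suffices h : ∃ ε > 0, ∀ x ∈ K, ‖x‖ < ε → x = 0 by
    obtain ⟨ε, hε, h⟩ := h
    refine discreteTopology_of_isOpen_singleton_zero ?_
    have : ({0} : Set K) = {x : K | ‖(x : W)‖ < ε} := by
      ext x
      simp only [Set.mem_singleton_iff, Set.mem_ofPred_eq]
      refine ⟨fun hx => by simpa [hx] using hε, fun hx => Subtype.ext (h x x.2 hx)⟩
    rw [this]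
    exact isOpen_lt (by fun_prop) continuous_const
  by_contra! hcon
  have hpos : ∀ k : ℕ, (0 : ℝ) < 1 / ((k : ℝ) + 1) := fun k => by positivity
  choose x hxK hxlt hx0 using fun k : ℕ => hcon _ (hpos k)
  have hxn : ∀ k, 0 < ‖x k‖ := fun k => norm_pos_iff.mpr (hx0 k)
  have hxt : Tendsto (fun k => ‖x k‖) atTop (𝓝 0) :=
    squeeze_zero (fun k => norm_nonneg _) (fun k => (hxlt k).le)
      tendsto_one_div_add_atTop_nhds_zero_nat
  obtain ⟨u, hu, s, hs, hlim⟩ := (isCompact_sphere (0 : W) 1).tendsto_subseq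
    (x := fun k => ‖x k‖⁻¹ • x k) (fun k => by simp [norm_smul, (hxn k).ne'])
  have hu0 : u ≠ 0 := by
    rintro rfl
    simp at hu
  refine hu0 (hline u fun t => ?_)
  -- Rounding the coefficient `t / ‖x‖` to an integer moves the point by at most `‖x‖`, which tends
  -- to zero; so integral multiples of short elements of `K` fill the line through `u`.
  have h1 : Tendsto (fun k => (⌊t / ‖x (s k)‖⌋ : ℝ) • x (s k) - t • (‖x (s k)‖⁻¹ • x (s k)))
      atTop (𝓝 0) := by
    refine squeeze_zero_norm (fun k => ?_) (hxt.comp hs.tendsto_atTop)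
    have h2 := hxn (s k)
    rw [smul_smul, ← sub_smul, norm_smul, ← div_eq_mul_inv, Real.norm_eq_abs, abs_sub_comm,
      Int.self_sub_floor, Int.abs_fract]
    simpa using mul_le_mul_of_nonneg_right (Int.fract_lt_one (t / ‖x (s k)‖)).le h2.le
  have h3 : Tendsto (fun k => (⌊t / ‖x (s k)‖⌋ : ℝ) • x (s k)) atTop (𝓝 (t • u)) := by
    simpa using h1.add (hlim.const_smul t)
  refine hK.mem_of_tendsto h3 (Eventually.of_forall fun k => ?_)
  rw [Int.cast_smul_eq_zsmul]
  exact K.zsmul_mem (hxK _) _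

/-- A discrete subgroup of a nontrivial finite-dimensional space is mapped to the integers by some
nonzero functional. -/
theorem exists_integral_functional_of_discrete {W : Type*} [NormedAddCommGroup W]
    [NormedSpace ℝ W] [FiniteDimensional ℝ W] [Nontrivial W] (K : Submodule ℤ W)
    [DiscreteTopology K] :
    ∃ θ : W →ₗ[ℝ] ℝ, θ ≠ 0 ∧ ∀ x ∈ K, ∃ z : ℤ, θ x = z := by
  by_cases hspan : Submodule.span ℝ (K : Set W) = ⊤
  · have : IsZLattice ℝ K := ⟨hspan⟩
    have : Module.Free ℤ K := ZLattice.module_free ℝ K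
    let b := (Module.Free.chooseBasis ℤ K)
    let B := b.ofZLatticeBasis ℝ K
    obtain ⟨i⟩ := B.index_nonempty
    refine ⟨B.coord i, fun h => ?_, fun x hx => ⟨b.repr ⟨x, hx⟩ i, ?_⟩⟩
    · have := congrArg (fun θ => θ (B i)) h
      simp at this
    · exact b.ofZLatticeBasis_repr_apply ℝ K ⟨x, hx⟩ i
  · obtain ⟨θ, hθ, hle⟩ := Submodule.exists_le_ker_of_lt_top _ (lt_top_iff_ne_top.mpr hspan)
    exact ⟨θ, hθ, fun x hx => ⟨0, by simpa using hle (Submodule.subset_span hx)⟩⟩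

/-- A subgroup of a finite-dimensional real space is dense if no nonzero linear functional takes
integral values on it. -/
theorem dense_of_integral_functionals {E : Type*} [NormedAddCommGroup E] [NormedSpace ℝ E]
    [FiniteDimensional ℝ E] (H : AddSubgroup E)
    (h : ∀ θ : E →ₗ[ℝ] ℝ, (∀ x ∈ H, ∃ z : ℤ, θ x = z) → θ = 0) : Dense (H : Set E) := by
  let C := H.topologicalClosure
  -- The largest subspace inside the closure. On a complement `W` the closure contains no line, so
  -- it is discrete there; if `W` is nonzero, an integral functional on `W` extends by zero on `V`
  -- to one that is integral on `H`.
  let V : Submodule ℝ E :=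
    { carrier := {x | ∀ t : ℝ, t • x ∈ C}
      add_mem' := fun hx hy t => by rw [smul_add]; exact C.add_mem (hx t) (hy t)
      zero_mem' := fun t => by rw [smul_zero]; exact C.zero_mem
      smul_mem' := fun c x hx t => by rw [smul_smul]; exact hx _ }
  have hVC : ∀ x ∈ V, x ∈ C := fun x hx => by simpa using hx 1
  obtain ⟨W, hW⟩ := V.exists_isCompl
  by_cases hVtop : V = ⊤
  · intro x
    exact hVC x (hVtop ▸ Submodule.mem_top)
  exfalso
  have hWnt : Nontrivial W := by
    rw [Submodule.nontrivial_iff_ne_bot]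
    rintro rfl
    exact hVtop (by simpa using hW.sup_eq_top)
  let K : AddSubgroup W := C.comap W.subtype.toAddMonoidHom
  have hKdisc : DiscreteTopology K := by
    refine discreteTopology_of_no_line K ?_ fun u hu => ?_
    · exact H.isClosed_topologicalClosure.preimage continuous_subtype_val
    · have huV : (u : E) ∈ V := fun t => hu t
      exact Subtype.ext ((Submodule.disjoint_def.mp hW.disjoint) u huV u.2)
  have : DiscreteTopology (AddSubgroup.toIntSubmodule K) := hKdisc
  obtain ⟨θ, hθ, hint⟩ := exists_integral_functional_of_discrete (AddSubgroup.toIntSubmodule K)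
  let p := W.projectionOnto V hW.symm
  refine hθ ?_
  have hz : θ ∘ₗ p = 0 := by
    refine h _ fun x hx => ?_
    refine hint (p x) ?_
    change ((p x : W) : E) ∈ C
    have hx' : x - (p x : E) ∈ V := by
      have : p (x - (p x : E)) = 0 := by
        rw [map_sub, Submodule.projectionOnto_apply_left]; simp
      rwa [Submodule.projectionOnto_apply_eq_zero_iff] at this
    have h3 : ((p x : W) : E) = x - (x - (p x : E)) := by abel
    rw [h3]
    exact C.sub_mem (H.le_topologicalClosure hx) (hVC _ hx')
  ext w
  have := congrArg (fun g => g (w : E)) hz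
  simpa [p, Submodule.projectionOnto_apply_left] using this

end CutProject

namespace CutProject

open Polynomial Matrix

/-! ### A real orthogonal matrix with rows independent over the algebraic numbers -/

theorem exists_transcendental_real : ∃ τ : ℝ, Transcendental ℚ (τ : ℂ) := by
  obtain ⟨m, hm⟩ : ∃ x : ℝ, Transcendental ℤ x :=
    ⟨_, transcendental_liouvilleNumber (m := 2) le_rfl⟩
  refine ⟨m, fun h => hm ?_⟩
  have h1 : IsAlgebraic ℤ (algebraMap ℝ ℂ m) := (IsFractionRing.isAlgebraic_iff ℤ ℚ ℂ).mpr h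
  exact (isAlgebraic_algebraMap_iff (algebraMap ℝ ℂ).injective).mp h1

theorem isAlgebraic_sum {ι : Type*} (s : Finset ι) (g : ι → ℂ)
    (h : ∀ i ∈ s, IsAlgebraic ℚ (g i)) : IsAlgebraic ℚ (∑ i ∈ s, g i) :=
  mem_algebraicClosure_iff.mp (sum_mem fun i hi => mem_algebraicClosure_iff.mpr (h i hi))

/-- A polynomial with algebraic coefficients that vanishes at a transcendental number is zero. -/
theorem coeff_eq_zero_of_transcendental {τ : ℂ} (hτ : Transcendental ℚ τ) (p : ℂ[X])
    (hp : ∀ i, IsAlgebraic ℚ (p.coeff i)) (h : p.eval τ = 0) : p = 0 := by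
  have hlift : p ∈ lifts (algebraMap (algebraicClosure ℚ ℂ) ℂ) := by
    rw [lifts_iff_coeff_lifts]
    exact fun i => ⟨⟨p.coeff i, mem_algebraicClosure_iff.mpr (hp i)⟩, rfl⟩
  obtain ⟨q, rfl⟩ := (mem_lifts _).mp hlift
  by_contra hne
  have hq : q ≠ 0 := by
    rintro rfl
    simp at hne
  have : IsAlgebraic (algebraicClosure ℚ ℂ) τ := ⟨q, hq, by rwa [eval_map_algebraMap] at h⟩
  have : Algebra.IsAlgebraic ℚ (algebraicClosure ℚ ℂ) := algebraicClosure.isAlgebraic ℚ ℂ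
  exact hτ (IsAlgebraic.restrictScalars ℚ ‹IsAlgebraic _ τ›)

/-- The rows of a suitable real orthogonal matrix are linearly independent over the algebraic
numbers. -/
theorem exists_orthogonal_independent_rows (N : ℕ) :
    ∃ T : Matrix (Fin N) (Fin N) ℝ, T * Tᵀ = 1 ∧ ∀ (a : Fin N) (c : Fin N → ℂ),
      (∀ j, IsAlgebraic ℚ (c j)) → ∑ j, (T a j : ℂ) * c j = 0 → c = 0 := by
  obtain ⟨τ, hτ⟩ := exists_transcendental_real
  rcases Nat.eq_zero_or_pos N with rfl | hN
  · exact ⟨1, by simp, fun a => a.elim0⟩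
  -- The matrix is the Householder reflection along the vector of powers of a transcendental number.
  let v : Fin N → ℝ := fun j => τ ^ (j : ℕ)
  let D : ℝ := ∑ j, v j * v j
  have hD : 0 < D := by
    refine Finset.sum_pos' (fun j _ => mul_self_nonneg _) ⟨⟨0, hN⟩, Finset.mem_univ _, ?_⟩
    simp [v]
  let V : Matrix (Fin N) (Fin N) ℝ := vecMulVec v v
  have hVT : Vᵀ = V := by simp [V, transpose_vecMulVec]
  have hVV : V * V = D • V := by
    ext i j
    simp only [V, mul_apply, vecMulVec_apply, Matrix.smul_apply, smul_eq_mul, D, Finset.sum_mul]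
    exact Finset.sum_congr rfl fun x _ => by ring
  refine ⟨1 - (2 / D) • V, ?_, fun a c hc h => ?_⟩
  · rw [transpose_sub, transpose_one, transpose_smul, hVT, sub_mul, mul_sub, mul_sub]
    simp only [one_mul, mul_one, smul_mul_smul_comm, hVV, smul_smul]
    have : 2 / D * (2 / D) * D = 2 * (2 / D) := by field_simp
    rw [this, mul_smul, two_smul]
    abel
  -- The relation for row `a`, multiplied by `D = ∑ τ ^ (2 * j)`, read as a polynomial in `τ`.
  let p : ℂ[X] := C (c a) * ∑ j : Fin N, X ^ (2 * (j : ℕ)) -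
    C 2 * ∑ j : Fin N, C (c j) * X ^ ((a : ℕ) + j)
  have hp : p = 0 := by
    refine coeff_eq_zero_of_transcendental hτ p (fun i => ?_) ?_
    · have h2 : IsAlgebraic ℚ (2 : ℂ) := by
        simpa using isAlgebraic_algebraMap (R := ℚ) (A := ℂ) (2 : ℚ)
      simp only [p, coeff_sub, coeff_C_mul, finsetSum_coeff, coeff_X_pow]
      refine ((hc a).mul ?_).sub (h2.mul ?_)
      · refine isAlgebraic_sum _ _ fun j _ => ?_
        split_ifs
        exacts [isAlgebraic_one, isAlgebraic_zero]
      · refine isAlgebraic_sum _ _ fun j _ => (hc j).mul ?_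
        split_ifs
        exacts [isAlgebraic_one, isAlgebraic_zero]
    · have hD' : (D : ℂ) ≠ 0 := by exact_mod_cast hD.ne'
      have h1 : ∀ j, (((1 - (2 / D) • V : Matrix (Fin N) (Fin N) ℝ) a j : ℝ) : ℂ) * c j * D =
          (if a = j then c j * D else 0) - 2 * (c j * (τ : ℂ) ^ ((a : ℕ) + j)) := by
        intro j
        simp only [Matrix.sub_apply, Matrix.smul_apply, V, vecMulVec_apply, v, one_apply,
          smul_eq_mul, pow_add]
        push_cast
        split_ifs <;> field_simp <;> push_cast <;> ring
      have h2 : (∑ j, ((1 - (2 / D) • V : Matrix (Fin N) (Fin N) ℝ) a j : ℂ) * c j) * D = 0 := by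
        rw [h, zero_mul]
      rw [Finset.sum_mul, Finset.sum_congr rfl fun j _ => h1 j, Finset.sum_sub_distrib,
        Finset.sum_ite_eq Finset.univ a, if_pos (Finset.mem_univ _), ← Finset.mul_sum] at h2
      have h3 : (D : ℂ) = ∑ j : Fin N, (τ : ℂ) ^ (2 * (j : ℕ)) := by
        simp [D, v, two_mul, pow_add]
      simpa [p, eval_finsetSum, h3] using h2
  -- The constant coefficient of `p` is `-c a` if `a` is the first index and `c a` otherwise. Once
  -- the first sum is gone, the coefficient at `a + b` is `-2 * c b`.
  have hca : c a = 0 := by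
    have h0 := congrArg (fun q => q.coeff 0) hp
    have h1 : ∀ j : Fin N, (0 = 2 * (j : ℕ)) ↔ (⟨0, hN⟩ : Fin N) = j := fun j => by
      rw [Fin.ext_iff]; simp; omega
    have h2 : ∀ j : Fin N, (0 = (a : ℕ) + j) ↔ (a = ⟨0, hN⟩ ∧ (⟨0, hN⟩ : Fin N) = j) := fun j => by
      rw [Fin.ext_iff, Fin.ext_iff]; simp; omega
    simp only [p, coeff_sub, coeff_C_mul, finsetSum_coeff, coeff_X_pow, h1, h2, coeff_zero] at h0
    by_cases ha : a = ⟨0, hN⟩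
    · subst ha
      simp at h0
      linear_combination -h0
    · simpa [ha] using h0
  ext b
  have h0 := congrArg (fun q => q.coeff (a + b)) hp
  have h1 : ∀ j : Fin N, ((a : ℕ) + b = a + j) ↔ b = j := fun j => by
    rw [Fin.ext_iff]; omega
  simp only [p, coeff_sub, coeff_C_mul, finsetSum_coeff, coeff_X_pow, h1, coeff_zero, hca] at h0
  simpa using h0

/-! ### Integral functionals and the quotient of a polynomial by a linear factor -/

theorem minpoly_eq_map {f : ℤ[X]} (hf : f.Monic) (hirr : Irreducible (f.map (Int.castRingHom ℚ)))
    {z : ℂ} (hz : aeval z f = 0) :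
    minpoly ℚ z = f.map (Int.castRingHom ℚ) := by
  refine (minpoly.eq_of_irreducible_of_monic hirr ?_ (hf.map _)).symm
  rw [← algebraMap_int_eq, aeval_map_algebraMap, hz]

/-- An integral polynomial of degree less than `f.natDegree` vanishing at a root of an
irreducible `f` is zero. -/
theorem eq_zero_of_sum_pow_eq_zero {f : ℤ[X]} (hf : f.Monic)
    (hirr : Irreducible (f.map (Int.castRingHom ℚ))) {z : ℂ} (hz : aeval z f = 0)
    {d : ℕ} (hd : f.natDegree = d) (w : Fin d → ℤ)
    (h : ∑ k, (w k : ℂ) * z ^ (k : ℕ) = 0) : w = 0 := by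
  subst hd
  let p : ℤ[X] := ∑ k : Fin f.natDegree, C (w k) * X ^ (k : ℕ)
  have hcoeff : ∀ k : Fin f.natDegree, p.coeff k = w k := fun k => by
    have h1 : ∀ j : Fin f.natDegree, ((k : ℕ) = j) ↔ k = j := fun j => by rw [Fin.ext_iff]
    simp [p, coeff_X_pow, h1]
  have hp0 : aeval z p = 0 := by simpa [p] using h
  have hdeg : p.degree < f.degree := by
    rw [degree_eq_natDegree hf.ne_zero]
    refine (degree_sum_le _ _).trans_lt ?_
    rw [Finset.sup_lt_iff (WithBot.bot_lt_coe _)]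
    exact fun k _ => (degree_C_mul_X_pow_le _ _).trans_lt (by exact_mod_cast k.2)
  have hp : p = 0 := by
    by_contra hne
    have hdvd : f.map (Int.castRingHom ℚ) ∣ p.map (Int.castRingHom ℚ) := by
      rw [← minpoly_eq_map hf hirr hz]
      refine minpoly.dvd _ _ ?_
      rw [← algebraMap_int_eq, aeval_map_algebraMap, hp0]
    have := (map_dvd_map _ Int.cast_injective hf).mp hdvd
    exact (degree_le_of_dvd this hne).not_gt hdeg
  ext k
  rw [← hcoeff, hp]
  simp

/-- If an integral functional kills the cofactor of a linear factor of an irreducible polynomial,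
then it vanishes. -/
theorem eq_zero_of_sum_coeff_divByMonic {f : ℤ[X]} (hf : f.Monic)
    (hirr : Irreducible (f.map (Int.castRingHom ℚ))) {z : ℂ} (hz : aeval z f = 0)
    {d : ℕ} (hd : f.natDegree = d) (w : Fin d → ℤ)
    (h : ∑ k, (w k : ℂ) * ((f.map (Int.castRingHom ℂ)) /ₘ (X - C z)).coeff k = 0) : w = 0 := by
  -- The coefficient `k` of the cofactor is `∑ e, z ^ e * f.coeff (k + e + 1)`, so the pairing with
  -- `w` is an integral polynomial in `z` of degree below `d`, with coefficients `g`.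
  let g : Fin d → ℤ := fun e => ∑ k : Fin d, w k * f.coeff (k + e + 1)
  have hg : g = 0 := by
    refine eq_zero_of_sum_pow_eq_zero hf hirr hz hd g ?_
    rw [← h]
    have h1 : ∀ k : Fin d, ((f.map (Int.castRingHom ℂ)) /ₘ (X - C z)).coeff k =
        ∑ e : Fin d, z ^ (e : ℕ) * (f.coeff (k + e + 1) : ℂ) := by
      intro k
      rw [coeff_divByMonic_X_sub_C, hf.natDegree_map, hd, Finset.sum_fin_eq_sum_range]
      refine Finset.sum_bij_ne_zero (fun i _ _ => i - (k + 1)) ?_ ?_ ?_ ?_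
      · intro i hi _
        simp at hi ⊢
        omega
      · intro i hi _ j hj _ hij
        simp at hi hj
        omega
      · intro e he hne
        simp only [Finset.mem_range] at he
        rw [dif_pos he] at hne
        have hle : (k : ℕ) + e + 1 ≤ d := by
          by_contra hcon
          refine hne ?_
          simp [coeff_eq_zero_of_natDegree_lt (show f.natDegree < k + e + 1 by omega)]
        refine ⟨k + e + 1, by simp; omega, ?_, by omega⟩
        have : (k : ℕ) + e + 1 - (k + 1) = e := by omega
        simpa [this] using hne
      · intro i hi _
        simp only [Finset.mem_Icc] at hi
        have h2 : i - ((k : ℕ) + 1) < d := by omega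
        have h3 : (k : ℕ) + (i - (k + 1)) + 1 = i := by omega
        rw [dif_pos h2]
        simp [h3]
    simp only [h1, g, Finset.mul_sum, Int.cast_sum, Finset.sum_mul]
    rw [Finset.sum_comm]
    refine Finset.sum_congr rfl fun k _ => Finset.sum_congr rfl fun e _ => ?_
    push_cast
    ring
  -- The system `g = 0` is triangular: at `e = d - 1 - r`, the entry `w r` meets the leading
  -- coefficient of `f` and later entries meet coefficients beyond the degree.
  have key : ∀ r : ℕ, ∀ hr : r < d, w ⟨r, hr⟩ = 0 := by
    intro r
    induction r using Nat.strong_induction_on with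
    | _ r ih =>
      intro hr
      have h1 := congrFun hg ⟨d - 1 - r, by omega⟩
      simp only [g, Pi.zero_apply] at h1
      rw [Finset.sum_eq_single ⟨r, hr⟩] at h1
      · have h2 : r + (d - 1 - r) + 1 = d := by omega
        simpa [h2, hd ▸ hf.coeff_natDegree] using h1
      · intro k _ hk
        rcases lt_or_gt_of_ne (fun h => hk (Fin.ext h) : (k : ℕ) ≠ r) with hlt | hgt
        · have := ih k hlt k.2
          simp [show w k = 0 from this]
        · rw [coeff_eq_zero_of_natDegree_lt (show f.natDegree < k + (d - 1 - r) + 1 by omega)]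
          simp
      · simp
  ext k
  exact key k k.2

end CutProject

namespace CutProject

open Polynomial Matrix ComplexConjugate

variable {n : ℕ} (A : Matrix (Fin n) (Fin n) ℝ)

/-! ### Eigenvalues, multiplicities and eigenbases -/

theorem charpoly_complexify : (complexify A).charpoly = A.charpoly.map (algebraMap ℝ ℂ) :=
  charpoly_map A _

theorem mult_conj (z : ℂ) : mult A (conj z) = mult A z := by
  unfold mult
  rw [eq_rootMultiplicity_map (p := (complexify A).charpoly) (starRingEnd ℂ).injective z,
    charpoly_complexify, Polynomial.map_map]
  congr 2
  ext x
  simp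

theorem mult_pos_iff (z : ℂ) : 0 < mult A z ↔ z ∈ spectrum ℂ (complexify A) := by
  rw [mult, rootMultiplicity_pos (charpoly_monic _).ne_zero, mem_spectrum_iff_isRoot_charpoly]

theorem charpoly_eq_of_diagonalizes {P : Matrix (Fin n) (Fin n) ℂ} {v : Fin n → ℂ}
    (hP : IsUnit P) (h : complexify A * P = P * diagonal v) :
    (complexify A).charpoly = ∏ l, (X - C (v l)) := by
  obtain ⟨Q, rfl⟩ := hP
  have : complexify A = Q * diagonal v * (Q⁻¹ : (Matrix (Fin n) (Fin n) ℂ)ˣ) := by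
    rw [← h, mul_assoc, Units.mul_inv, mul_one]
  rw [this, Matrix.coe_units_inv, charpoly_units_conj, charpoly_diagonal]

theorem mult_eq_card_of_diagonalizes {P : Matrix (Fin n) (Fin n) ℂ} {v : Fin n → ℂ}
    (hP : IsUnit P) (h : complexify A * P = P * diagonal v) (z : ℂ) :
    mult A z = Fintype.card {l // v l = z} := by
  classical
  have h1 : ∏ l, (X - C (v l)) = ((Finset.univ.val.map v).map fun a => X - C a).prod := by
    rw [Multiset.map_map]
    rfl
  rw [mult, charpoly_eq_of_diagonalizes A hP h, h1, ← count_roots, roots_multiset_prod_X_sub_C,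
    Multiset.count_map, Fintype.card_subtype, Finset.card_def, Finset.filter_val]
  simp [eq_comm]

/-- The pairs of an eigenvalue and a number less than its multiplicity. -/
abbrev EigenIndex : Type := {x : ℂ × ℕ // x.2 < mult A x.1}

/-- Complex conjugation on the pairs of an eigenvalue and a number. -/
def EigenIndex.conj (x : EigenIndex A) : EigenIndex A :=
  ⟨(starRingEnd ℂ x.1.1, x.1.2), by rw [mult_conj]; exact x.2⟩

theorem EigenIndex.conj_conj (x : EigenIndex A) :
    EigenIndex.conj A (EigenIndex.conj A x) = x := by
  simp [EigenIndex.conj]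

/-- The algebraic multiplicity of `z` counts the diagonal entries equal to `z`, so the columns of a
diagonalizing matrix can be relabelled by pairs of an eigenvalue and a number. -/
theorem exists_eigenbasis (hdiag : DiagonalizableOverC A) :
    ∃ u : Module.Basis (EigenIndex A) ℂ (Fin n → ℂ),
      ∀ x, complexify A *ᵥ u x = x.1.1 • u x := by
  obtain ⟨P, v, hP, h⟩ := hdiag
  have e1 : ∀ z, {l // v l = z} ≃ {a : ℕ // a < mult A z} := fun z =>
    (Fintype.equivFinOfCardEq (mult_eq_card_of_diagonalizes A hP h z).symm).trans Fin.equivSubtype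
  let e : Fin n ≃ EigenIndex A := (Equiv.sigmaFiberEquiv v).symm.trans
    ((Equiv.sigmaCongrRight e1).trans
      (Equiv.subtypeProdEquivSigmaSubtype fun z a => a < mult A z).symm)
  have he : ∀ l, (e l).1.1 = v l := fun l => rfl
  have : Invertible P := hP.invertible
  let b : Module.Basis (Fin n) ℂ (Fin n → ℂ) := (Pi.basisFun ℂ (Fin n)).map (P.toLinearEquiv' this)
  have hb : ∀ l, b l = P *ᵥ Pi.single l 1 := fun l => by
    simp [b, Matrix.toLinearEquiv', Pi.basisFun_apply]
  refine ⟨b.reindex e, fun x => ?_⟩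
  obtain ⟨l, rfl⟩ := e.surjective x
  rw [Module.Basis.reindex_apply, Equiv.symm_apply_apply, he, hb, mulVec_mulVec, h,
    ← mulVec_mulVec, diagonal_mulVec_single, mul_one, ← mulVec_smul]
  congr 1
  ext j
  simp [Pi.single_apply]

/-- A real matrix that is diagonalizable over `ℂ` has an eigenbasis invariant under complex
conjugation. -/
theorem exists_conj_eigenbasis (hdiag : DiagonalizableOverC A) :
    ∃ u : Module.Basis (EigenIndex A) ℂ (Fin n → ℂ),
      (∀ x, complexify A *ᵥ u x = x.1.1 • u x) ∧ ∀ x, u (EigenIndex.conj A x) = star (u x) := by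
  obtain ⟨b, hb⟩ := exists_eigenbasis A hdiag
  -- The new basis is `ζ • b x + conj ζ • star (b (conj x))`, which is symmetric for every `ζ`. It
  -- is a basis when `ζ + conj ζ • G` is invertible, that is, when `-ζ / conj ζ` is not an
  -- eigenvalue of `G`; infinitely many such quotients are available.
  let G : Module.End ℂ (Fin n → ℂ) := b.constr ℂ fun x => star (b (EigenIndex.conj A x))
  have hG : ∀ x, G (b x) = star (b (EigenIndex.conj A x)) := fun x => b.constr_basis ℂ _ x
  let ζ : ℝ → ℂ := fun t => 1 + t * Complex.I
  have hre : ∀ t, (ζ t).re = 1 := fun t => by simp [ζ]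
  have hζ : ∀ t, conj (ζ t) ≠ 0 := fun t h => by
    have := congrArg Complex.re h
    rw [Complex.conj_re, hre] at this
    simp at this
  have hinj : Function.Injective fun t : ℝ => -(ζ t) / conj (ζ t) := by
    intro s t hst
    have h1 := (div_eq_div_iff (hζ s) (hζ t)).mp hst
    have h2 := congrArg Complex.im h1
    simp [ζ] at h2
    linarith
  obtain ⟨t, ht⟩ : ∃ t : ℝ, -(ζ t) / conj (ζ t) ∉ spectrum ℂ G := by
    by_contra! hcon
    exact (Set.infinite_range_of_injective hinj)
      (G.finite_spectrum.subset (Set.range_subset_iff.mpr hcon))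
  have hunit : IsUnit (ζ t • (1 : Module.End ℂ (Fin n → ℂ)) + conj (ζ t) • G) := by
    rw [spectrum.notMem_iff] at ht
    have : ζ t • (1 : Module.End ℂ (Fin n → ℂ)) + conj (ζ t) • G =
        algebraMap ℂ _ (-conj (ζ t)) * (algebraMap ℂ _ (-(ζ t) / conj (ζ t)) - G) := by
      rw [mul_sub, ← map_mul, ← Algebra.smul_def, Algebra.algebraMap_eq_smul_one]
      rw [neg_smul, sub_neg_eq_add]
      congr 2
      field_simp [hζ t]
    rw [this]
    exact ((IsUnit.mk0 _ (neg_ne_zero.mpr (hζ t))).map _).mul ht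
  let F := LinearEquiv.ofBijective _ ((Module.End.isUnit_iff _).mp hunit)
  have hF : ∀ x, b.map F x = ζ t • b x + conj (ζ t) • star (b (EigenIndex.conj A x)) := fun x => by
    simp [F, hG]
  refine ⟨b.map F, fun x => ?_, fun x => ?_⟩
  · have h1 : complexify A *ᵥ star (b (EigenIndex.conj A x)) =
        x.1.1 • star (b (EigenIndex.conj A x)) := by
      have h2 := congrArg star (hb (EigenIndex.conj A x))
      rw [star_smul] at h2
      have h3 : star (complexify A *ᵥ b (EigenIndex.conj A x)) =
          complexify A *ᵥ star (b (EigenIndex.conj A x)) := by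
        ext i
        simp [mulVec, dotProduct, complexify]
      rw [← h3, h2]
      simp [EigenIndex.conj]
    rw [hF, mulVec_add, mulVec_smul, mulVec_smul, hb, h1, smul_add, smul_comm,
      smul_comm (conj (ζ t))]
  · rw [hF, hF, EigenIndex.conj_conj, star_add, star_smul, star_smul, star_star]
    simp only [Complex.star_def, Complex.conj_conj]
    rw [add_comm]

end CutProject

namespace CutProject

open Matrix

/-! ### Schemes from linear data -/

/-- The coordinates in physical and internal space, put together. -/
def joinProj {E : Type*} [AddCommGroup E] [Module ℝ E] {n m : ℕ} (φ : E →ₗ[ℝ] (Fin n → ℝ))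
    (ψ : E →ₗ[ℝ] (Fin m → ℝ)) : E →ₗ[ℝ] (Fin (n + m) → ℝ) where
  toFun c := Fin.append (φ c) (ψ c)
  map_add' c d := by
    ext i
    refine Fin.addCases (fun i => ?_) (fun i => ?_) i <;> simp
  map_smul' r c := by
    ext i
    refine Fin.addCases (fun i => ?_) (fun i => ?_) i <;> simp

theorem physProj_joinProj {E : Type*} [AddCommGroup E] [Module ℝ E] {n m : ℕ}
    (φ : E →ₗ[ℝ] (Fin n → ℝ)) (ψ : E →ₗ[ℝ] (Fin m → ℝ)) (c : E) :
    physProj n m (joinProj φ ψ c) = φ c := by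
  ext i
  simp [physProj, joinProj]

theorem intProj_joinProj {E : Type*} [AddCommGroup E] [Module ℝ E] {n m : ℕ}
    (φ : E →ₗ[ℝ] (Fin n → ℝ)) (ψ : E →ₗ[ℝ] (Fin m → ℝ)) (c : E) :
    intProj n m (joinProj φ ψ c) = ψ c := by
  ext i
  simp [intProj, joinProj]

/-- A vector of integers as a vector of reals. -/
def intVec {ι : Type*} : (ι → ℤ) →+ (ι → ℝ) where
  toFun c i := c i
  map_zero' := by ext; simp
  map_add' c d := by ext; simp

@[simp] theorem intVec_apply {ι : Type*} (c : ι → ℤ) (i : ι) : intVec c i = c i := rfl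

/-- A self-similar set exists if the standard lattice `ℤ^ι` has projections to physical and
internal space that make it a generic scheme, and the action of `A` on the physical projection
of lattice points with internal projection in a window can be lifted. -/
theorem admitsSelfSimilarSet_of_linear_data {ι : Type*} [Fintype ι] {n m : ℕ}
    (A : Matrix (Fin n) (Fin n) ℝ) (hn : 1 ≤ n) (hm : 1 ≤ m) (hcard : Fintype.card ι = n + m)
    (φ : (ι → ℝ) →ₗ[ℝ] (Fin n → ℝ)) (ψ : (ι → ℝ) →ₗ[ℝ] (Fin m → ℝ))
    (hinj : ∀ c, φ c = 0 → ψ c = 0 → c = 0)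
    (hφ : ∀ c : ι → ℤ, φ (intVec c) = 0 → c = 0)
    (hψ : ∀ c : ι → ℤ, ψ (intVec c) = 0 → c = 0)
    (hdense : ∀ w : (ι → ℝ) →ₗ[ℝ] ℝ, (∀ c : ι → ℤ, ∃ z : ℤ, w (intVec c) = z) →
      (∀ c, ψ c = 0 → w c = 0) → w = 0)
    (Ω : Set (Fin m → ℝ)) (hΩ : IsWindow Ω)
    (hA : ∀ c : ι → ℤ, ψ (intVec c) ∈ Ω →
      ∃ c' : ι → ℤ, φ (intVec c') = A *ᵥ φ (intVec c) ∧ ψ (intVec c') ∈ Ω) :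
    AdmitsSelfSimilarSet A (Fintype.card ι) := by
  classical
  have hΘinj : Function.Injective (joinProj φ ψ) := by
    rw [← LinearMap.ker_eq_bot, LinearMap.ker_eq_bot']
    intro c hc
    refine hinj c ?_ ?_
    · rw [← physProj_joinProj φ ψ c, hc]
      rfl
    · rw [← intProj_joinProj φ ψ c, hc]
      rfl
  let Θ : (ι → ℝ) ≃ₗ[ℝ] (Fin (n + m) → ℝ) :=
    LinearEquiv.ofInjectiveOfFinrankEq (joinProj φ ψ) hΘinj (by simp [hcard])
  have hΘ : ∀ c, Θ c = joinProj φ ψ c := fun c => rfl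
  let e : ι ≃ Fin (n + m) := Fintype.equivFinOfCardEq hcard
  let b := ((Pi.basisFun ℝ ι).map Θ).reindex e
  let S : Scheme n m := ⟨hn, hm, Submodule.span ℤ (Set.range b), b, rfl⟩
  have hmem : ∀ x, x ∈ S.lattice ↔ ∃ c : ι → ℤ, joinProj φ ψ (intVec c) = x := by
    intro x
    change x ∈ Submodule.span ℤ (Set.range b) ↔ _
    rw [Module.Basis.range_reindex, Submodule.mem_span_range_iff_exists_fun]
    refine exists_congr fun c => ?_
    have : ∑ i, c i • ((Pi.basisFun ℝ ι).map Θ) i = joinProj φ ψ (intVec c) := by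
      rw [← hΘ, pi_eq_sum_univ' (intVec c), map_sum]
      refine Finset.sum_congr rfl fun i _ => ?_
      rw [map_smul, Module.Basis.map_apply, intVec_apply, Int.cast_smul_eq_zsmul]
      congr 2
    rw [this]
  have hψsurj : Function.Surjective ψ := fun y => by
    obtain ⟨c, hc⟩ := Θ.surjective (Fin.append 0 y)
    refine ⟨c, ?_⟩
    rw [← intProj_joinProj φ ψ c, ← hΘ, hc]
    ext j
    simp [intProj]
  refine ⟨m, hcard, S, ⟨?_, ?_, ?_⟩, Ω, hΩ, ?_⟩
  · rintro x hx y hy hxy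
    obtain ⟨c, rfl⟩ := (hmem x).mp hx
    obtain ⟨d, rfl⟩ := (hmem y).mp hy
    rw [physProj_joinProj, physProj_joinProj, ← sub_eq_zero, ← map_sub, ← map_sub] at hxy
    rw [sub_eq_zero.mp (hφ _ hxy)]
  · rintro x hx y hy hxy
    obtain ⟨c, rfl⟩ := (hmem x).mp hx
    obtain ⟨d, rfl⟩ := (hmem y).mp hy
    rw [intProj_joinProj, intProj_joinProj, ← sub_eq_zero, ← map_sub, ← map_sub] at hxy
    rw [sub_eq_zero.mp (hψ _ hxy)]
  · let H : AddSubgroup (Fin m → ℝ) := (ψ.toAddMonoidHom.comp intVec).range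
    have hH : (H : Set (Fin m → ℝ)) = intProj n m '' (S.lattice : Set (Fin (n + m) → ℝ)) := by
      ext y
      constructor
      · rintro ⟨c, rfl⟩
        exact ⟨_, (hmem _).mpr ⟨c, rfl⟩, intProj_joinProj _ _ _⟩
      · rintro ⟨x, hx, rfl⟩
        obtain ⟨c, rfl⟩ := (hmem x).mp hx
        exact ⟨c, (intProj_joinProj _ _ _).symm⟩
    rw [Scheme.IsIrreducible, ← hH]
    refine dense_of_integral_functionals H fun θ hθ => ?_
    -- Functionals on the internal space are pulled back to functionals on `ℝ^ι` that vanish on the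
    -- kernel of `ψ`; surjectivity of `ψ` loses nothing.
    have hw : θ ∘ₗ ψ = 0 :=
      hdense _ (fun c => hθ _ ⟨c, rfl⟩) fun c hc => by simp [hc]
    ext1 j
    obtain ⟨c, hc⟩ := hψsurj (LinearMap.single ℝ (fun _ => ℝ) j 1)
    have h1 := congrArg (fun g => g c) hw
    rw [LinearMap.comp_apply, hc] at h1
    ext
    simpa using h1
  · rintro y ⟨x, hx, hxΩ, rfl⟩
    obtain ⟨c, rfl⟩ := (hmem x).mp hx
    rw [intProj_joinProj] at hxΩ
    obtain ⟨c', h1, h2⟩ := hA c hxΩ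
    refine ⟨_, (hmem _).mpr ⟨c', rfl⟩, ?_, ?_⟩
    · rwa [intProj_joinProj]
    · rw [physProj_joinProj, physProj_joinProj, h1]

end CutProject

namespace CutProject

open Polynomial Matrix ComplexConjugate

/-! ### Interpolation at the roots of an irreducible integral polynomial -/

theorem mem_rootSet_iff_aeval {f : ℤ[X]} (hf : f.Monic) {z : ℂ} :
    z ∈ f.rootSet ℂ ↔ aeval z f = 0 := by
  rw [mem_rootSet]
  exact and_iff_right hf.ne_zero

theorem aeval_conj_eq_zero {f : ℤ[X]} {z : ℂ} (hz : aeval z f = 0) :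
    aeval (conj z) f = 0 := by
  have h := aeval_algHom_apply (starRingEnd ℂ).toIntAlgHom z f
  rw [hz, map_zero] at h
  exact h

theorem card_rootSet_of_irreducible {f : ℤ[X]} (hf : f.Monic)
    (hirr : Irreducible (f.map (Int.castRingHom ℚ))) :
    Fintype.card (f.rootSet ℂ) = f.natDegree := by
  have h := card_rootSet_eq_natDegree (K := ℂ) hirr.separable (IsAlgClosed.splits _)
  rw [hf.natDegree_map] at h
  rw [← h]
  refine Fintype.card_congr (Equiv.setCongr ?_)
  ext z
  rw [mem_rootSet_iff_aeval hf, mem_rootSet, ← algebraMap_int_eq, aeval_map_algebraMap]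
  exact (and_iff_right (hf.map _).ne_zero).symm

/-- Irreducibility makes the roots distinct, so the Vandermonde matrix at them is invertible. -/
theorem coeff_eq_zero_of_forall_root {f : ℤ[X]} (hf : f.Monic)
    (hirr : Irreducible (f.map (Int.castRingHom ℚ))) (γ : Fin f.natDegree → ℂ)
    (h : ∀ z ∈ f.rootSet ℂ, ∑ k, γ k * z ^ (k : ℕ) = 0) : γ = 0 := by
  have hcard := card_rootSet_of_irreducible hf hirr
  let e : Fin f.natDegree ≃ f.rootSet ℂ := (Fintype.equivFinOfCardEq hcard).symm
  refine Matrix.eq_zero_of_forall_index_sum_mul_pow_eq_zero (f := fun i => (e i : ℂ))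
    (fun i j hij => e.injective (Subtype.ext hij)) fun i => ?_
  exact h _ (e i).2

theorem exists_complex_interpolation {f : ℤ[X]} (hf : f.Monic)
    (hirr : Irreducible (f.map (Int.castRingHom ℚ))) (y : f.rootSet ℂ → ℂ) :
    ∃ γ : Fin f.natDegree → ℂ, ∀ z : f.rootSet ℂ, ∑ k, γ k * (z : ℂ) ^ (k : ℕ) = y z := by
  let F : (Fin f.natDegree → ℂ) →ₗ[ℂ] (f.rootSet ℂ → ℂ) :=
    { toFun := fun γ z => ∑ k, γ k * (z : ℂ) ^ (k : ℕ)
      map_add' := fun γ δ => by ext z; simp [add_mul, Finset.sum_add_distrib]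
      map_smul' := fun r γ => by ext z; simp [Finset.mul_sum, mul_assoc] }
  have hinj : Function.Injective F := by
    rw [← LinearMap.ker_eq_bot, LinearMap.ker_eq_bot']
    exact fun γ hγ => coeff_eq_zero_of_forall_root hf hirr γ fun z hz => congrFun hγ ⟨z, hz⟩
  have hsurj : Function.Surjective F :=
    (LinearMap.injective_iff_surjective_of_finrank_eq_finrank
      (by simp [card_rootSet_of_irreducible hf hirr])).mp hinj
  obtain ⟨γ, hγ⟩ := hsurj y
  exact ⟨γ, fun z => congrFun hγ z⟩

/-- Values at the roots that are compatible with complex conjugation are interpolated by a real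
polynomial. -/
theorem exists_real_interpolation {f : ℤ[X]} (hf : f.Monic)
    (hirr : Irreducible (f.map (Int.castRingHom ℚ))) (y : ℂ → ℂ)
    (hy : ∀ z, aeval z f = 0 → y (conj z) = conj (y z)) :
    ∃ c : Fin f.natDegree → ℝ, ∀ z, aeval z f = 0 → ∑ k, (c k : ℂ) * z ^ (k : ℕ) = y z := by
  obtain ⟨γ, hγ⟩ := exists_complex_interpolation hf hirr fun z => y z
  -- Since the data respect conjugation, conjugating the coefficients gives another interpolating
  -- polynomial; the real parts are the average of the two.
  refine ⟨fun k => (γ k).re, fun z hz => ?_⟩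
  have h1 := hγ ⟨z, (mem_rootSet_iff_aeval hf).mpr hz⟩
  have h2 := congrArg conj (hγ ⟨conj z, (mem_rootSet_iff_aeval hf).mpr (aeval_conj_eq_zero hz)⟩)
  simp only [map_sum, map_mul, map_pow, Complex.conj_conj, hy z hz] at h1 h2
  simp only [Complex.re_eq_add_conj, div_mul_eq_mul_div, add_mul, ← Finset.sum_div,
    Finset.sum_add_distrib, h1, h2]
  ring

/-- Multiplication by the variable modulo `f`, on integral coefficient vectors. -/
theorem exists_mul_root {f : ℤ[X]} (hf : f.Monic)
    (hirr : Irreducible (f.map (Int.castRingHom ℚ))) (c : Fin f.natDegree → ℤ) :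
    ∃ c' : Fin f.natDegree → ℤ, ∀ z : ℂ, aeval z f = 0 →
      ∑ k, (c' k : ℂ) * z ^ (k : ℕ) = z * ∑ k, (c k : ℂ) * z ^ (k : ℕ) := by
  have hf1 : f ≠ 1 := by
    rintro rfl
    simp at hirr
  let p : ℤ[X] := X * ∑ k, C (c k) * X ^ (k : ℕ)
  refine ⟨fun k => (p %ₘ f).coeff k, fun z hz => ?_⟩
  have h1 : aeval z (p %ₘ f) = aeval z p := by
    conv_rhs => rw [← modByMonic_add_div p f, map_add, map_mul, hz, zero_mul, add_zero]
  rw [aeval_eq_sum_range' (natDegree_modByMonic_lt p hf hf1)] at h1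
  rw [← Fin.sum_univ_eq_sum_range (fun k => (p %ₘ f).coeff k • z ^ k)] at h1
  simpa [p] using h1

/-! ### The model of the lattice -/

section Model

variable {n : ℕ} (A : Matrix (Fin n) (Fin n) ℝ) {k : ℕ} (f : Fin k → ℤ[X]) (N : Fin k → ℕ)

/-- Conditions on a family of polynomials and multiplicities under which a self-similar
cut-and-project set can be built from the rings `ℤ[X]/(f i)`. -/
structure IsModelData : Prop where
  monic : ∀ i, (f i).Monic
  irreducible : ∀ i, Irreducible ((f i).map (Int.castRingHom ℚ))
  injective : Function.Injective f
  exists_root : ∀ z, 0 < mult A z → ∃ i, aeval z (f i) = 0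
  mult_le : ∀ i z, aeval z (f i) = 0 → mult A z ≤ N i
  -- Each factor owns a physical and an internal value, which is what makes the two projections
  -- injective on the lattice.
  exists_mult_pos : ∀ i, ∃ z, aeval z (f i) = 0 ∧ 0 < mult A z
  exists_mult_lt : ∀ i, ∃ z, aeval z (f i) = 0 ∧ mult A z < N i
  norm_le_one : ∀ i z, aeval z (f i) = 0 → mult A z < N i → ‖z‖ ≤ 1

/-- Index set for the coefficients of `N i` polynomials of degree less than that of `f i`. -/
abbrev CoeffIndex : Type := Σ i, Fin (N i) × Fin (f i).natDegree

/-- Index set for the values of these polynomials at the roots of `f i`. -/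
abbrev ValueIndex : Type := Σ i, Fin (N i) × (f i).rootSet ℂ

variable {f N}

/-- The value at `z` of the polynomial number `j` that belongs to `f i`. -/
def polyEval (c : CoeffIndex f N → ℝ) (i : Fin k) (j : Fin (N i)) (z : ℂ) : ℂ :=
  ∑ e, (c ⟨i, j, e⟩ : ℂ) * z ^ (e : ℕ)

/-- The values at the roots, mixed by the matrices `T i`. -/
def valueMap (T : ∀ i, Matrix (Fin (N i)) (Fin (N i)) ℝ) :
    (CoeffIndex f N → ℝ) →ₗ[ℝ] (ValueIndex f N → ℂ) where
  toFun c q := ∑ j, (T q.1 q.2.1 j : ℂ) * polyEval c q.1 j q.2.2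
  map_add' c d := by
    ext q
    simp [polyEval, add_mul, mul_add, Finset.sum_add_distrib]
  map_smul' r c := by
    ext q
    simp only [polyEval, Pi.smul_apply, smul_eq_mul, Complex.ofReal_mul, mul_assoc,
      RingHom.id_apply, Complex.real_smul, Finset.mul_sum]
    exact Finset.sum_congr rfl fun j _ => Finset.sum_congr rfl fun e _ => by ring

theorem valueMap_apply (T : ∀ i, Matrix (Fin (N i)) (Fin (N i)) ℝ) (c : CoeffIndex f N → ℝ)
    (q : ValueIndex f N) :
    valueMap T c q = ∑ j, (T q.1 q.2.1 j : ℂ) * polyEval c q.1 j q.2.2 := rfl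

/-- Indices of the values that make up the physical space. -/
def IsPhysical (q : ValueIndex f N) : Prop := (q.2.1 : ℕ) < mult A q.2.2

/-- Vectors for which all values outside the physical space vanish. -/
def physPart (T : ∀ i, Matrix (Fin (N i)) (Fin (N i)) ℝ) :
    Submodule ℝ (CoeffIndex f N → ℝ) where
  carrier := {c | ∀ q, ¬ IsPhysical A q → valueMap T c q = 0}
  add_mem' hc hd q hq := by simp [hc q hq, hd q hq]
  zero_mem' q _ := by simp
  smul_mem' r c hc q hq := by simp [hc q hq]

/-- Vectors for which all values in the physical space vanish. -/
def intPart (T : ∀ i, Matrix (Fin (N i)) (Fin (N i)) ℝ) :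
    Submodule ℝ (CoeffIndex f N → ℝ) where
  carrier := {c | ∀ q, IsPhysical A q → valueMap T c q = 0}
  add_mem' hc hd q hq := by simp [hc q hq, hd q hq]
  zero_mem' q _ := by simp
  smul_mem' r c hc q hq := by simp [hc q hq]

variable {A} {T : ∀ i, Matrix (Fin (N i)) (Fin (N i)) ℝ}

theorem polyEval_eq_zero_of_valueMap (hT : ∀ i, T i * (T i)ᵀ = 1) (c : CoeffIndex f N → ℝ)
    (i : Fin k) (z : (f i).rootSet ℂ) (h : ∀ a, valueMap T c ⟨i, a, z⟩ = 0) (j : Fin (N i)) :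
    polyEval c i j z = 0 := by
  have h1 : (T i).map (algebraMap ℝ ℂ) *ᵥ (fun j => polyEval c i j z) = 0 := by
    ext a
    exact h a
  have h2 : ((T i).map (algebraMap ℝ ℂ))ᵀ * (T i).map (algebraMap ℝ ℂ) = 1 := by
    rw [← transpose_map, ← Matrix.map_mul, mul_eq_one_comm.mp (hT i)]
    simp
  have h3 := congrArg (fun v => ((T i).map (algebraMap ℝ ℂ))ᵀ *ᵥ v) h1
  simp only [mulVec_mulVec, h2, one_mulVec, mulVec_zero] at h3
  exact congrFun h3 j

theorem valueMap_injective (hf : ∀ i, (f i).Monic)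
    (hirr : ∀ i, Irreducible ((f i).map (Int.castRingHom ℚ))) (hT : ∀ i, T i * (T i)ᵀ = 1)
    (c : CoeffIndex f N → ℝ) (h : valueMap T c = 0) : c = 0 := by
  ext ⟨i, j, e⟩
  have := coeff_eq_zero_of_forall_root (hf i) (hirr i) (fun e => (c ⟨i, j, e⟩ : ℂ)) fun z hz =>
    polyEval_eq_zero_of_valueMap hT c i ⟨z, hz⟩ (fun a => congrFun h ⟨i, a, z, hz⟩) j
  simpa using congrFun this e

/-- The mixing is undone by the transpose of `T i`, which is real and so keeps the symmetry under
conjugation; then each copy is interpolated separately. -/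
theorem exists_valueMap_eq (hf : ∀ i, (f i).Monic)
    (hirr : ∀ i, Irreducible ((f i).map (Int.castRingHom ℚ))) (hT : ∀ i, T i * (T i)ᵀ = 1)
    (y : ∀ i, Fin (N i) → ℂ → ℂ)
    (hy : ∀ i a z, aeval z (f i) = 0 → y i a (conj z) = conj (y i a z)) :
    ∃ c : CoeffIndex f N → ℝ, ∀ q : ValueIndex f N, valueMap T c q = y q.1 q.2.1 q.2.2 := by
  have h1 : ∀ i (j : Fin (N i)), ∃ c : Fin (f i).natDegree → ℝ, ∀ z, aeval z (f i) = 0 →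
      ∑ e, (c e : ℂ) * z ^ (e : ℕ) = ∑ a, (T i a j : ℂ) * y i a z := by
    intro i j
    refine exists_real_interpolation (hf i) (hirr i) (fun z => ∑ a, (T i a j : ℂ) * y i a z)
      fun z hz => ?_
    simp [hy i _ z hz]
  choose c hc using h1
  refine ⟨fun x => c x.1 x.2.1 x.2.2, fun ⟨i, a, z, hz⟩ => ?_⟩
  rw [valueMap_apply]
  simp only [polyEval, hc i _ z ((mem_rootSet_iff_aeval (hf i)).mp hz), Finset.mul_sum]
  rw [Finset.sum_comm]
  have h2 : ∀ b, ∑ j, (T i a j : ℂ) * ((T i b j : ℂ) * y i b z) =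
      if a = b then y i b z else 0 := by
    intro b
    have h3 := congrFun (congrFun (hT i) a) b
    rw [mul_apply, one_apply] at h3
    have h4 : (∑ j, (T i a j : ℂ) * (T i b j : ℂ)) = if a = b then 1 else 0 := by
      have h5 := congrArg (fun r : ℝ => (r : ℂ)) h3
      simp only [transpose_apply] at h5
      rw [apply_ite (fun r : ℝ => (r : ℂ))] at h5
      push_cast at h5
      exact h5
    simp only [← mul_assoc, ← Finset.sum_mul, h4]
    split_ifs <;> simp
  simp [h2]

/-- Conjugate roots have equal multiplicity in `A`, so setting all internal values to zero respects
conjugation and is realized by a real vector. -/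
theorem isCompl_parts (hf : ∀ i, (f i).Monic)
    (hirr : ∀ i, Irreducible ((f i).map (Int.castRingHom ℚ))) (hT : ∀ i, T i * (T i)ᵀ = 1) :
    IsCompl (intPart (f := f) A T) (physPart A T) := by
  classical
  refine ⟨?_, ?_⟩
  · rw [Submodule.disjoint_def]
    intro c h1 h2
    refine valueMap_injective hf hirr hT c ?_
    ext q
    by_cases hq : IsPhysical A q
    exacts [h1 q hq, h2 q hq]
  · rw [codisjoint_iff, Submodule.eq_top_iff']
    intro c
    obtain ⟨d, hd⟩ := exists_valueMap_eq hf hirr hT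
      (fun i a z => if (a : ℕ) < mult A z then
        ∑ j, (T i a j : ℂ) * polyEval c i j z else 0) (fun i a z hz => by
        rw [mult_conj]
        split_ifs <;> simp [polyEval])
    rw [Submodule.mem_sup]
    refine ⟨c - d, fun q hq => ?_, d, fun q hq => ?_, by abel⟩
    · have hq' : (q.2.1 : ℕ) < mult A q.2.2 := hq
      rw [map_sub, Pi.sub_apply, hd, if_pos hq', valueMap_apply, sub_self]
    · have hq' : ¬ (q.2.1 : ℕ) < mult A q.2.2 := hq
      rw [hd, if_neg hq']

/-- The mixing coefficients do not depend on the root, so mixing commutes with multiplication by `X`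
in every copy. -/
theorem exists_valueMap_mul_root (hf : ∀ i, (f i).Monic)
    (hirr : ∀ i, Irreducible ((f i).map (Int.castRingHom ℚ))) (c : CoeffIndex f N → ℤ) :
    ∃ c' : CoeffIndex f N → ℤ, ∀ q : ValueIndex f N,
      valueMap T (intVec c') q = q.2.2 * valueMap T (intVec c) q := by
  choose d hd using fun i (j : Fin (N i)) => exists_mul_root (hf i) (hirr i) fun e => c ⟨i, j, e⟩
  refine ⟨fun x => d x.1 x.2.1 x.2.2, fun ⟨i, a, z, hz⟩ => ?_⟩
  rw [valueMap_apply, valueMap_apply, Finset.mul_sum]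
  refine Finset.sum_congr rfl fun j _ => ?_
  have h1 := hd i j z ((mem_rootSet_iff_aeval (hf i)).mp hz)
  simp only [polyEval, intVec_apply, Complex.ofReal_intCast]
  rw [h1]
  ring

end Model

end CutProject

namespace CutProject

open Polynomial Matrix ComplexConjugate

variable {n : ℕ} {A : Matrix (Fin n) (Fin n) ℝ} {k : ℕ} {f : Fin k → ℤ[X]} {N : Fin k → ℕ}
  {T : ∀ i, Matrix (Fin (N i)) (Fin (N i)) ℝ}

/-! ### The physical projection of the model -/

theorem IsModelData.eq_of_root (h : IsModelData A f N) {i j : Fin k} {z : ℂ}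
    (hi : aeval z (f i) = 0) (hj : aeval z (f j) = 0) : i = j := by
  refine h.injective (map_injective (Int.castRingHom ℚ) Int.cast_injective ?_)
  rw [← minpoly_eq_map (h.monic i) (h.irreducible i) hi,
    minpoly_eq_map (h.monic j) (h.irreducible j) hj]

theorem IsModelData.valueIndex_ext (h : IsModelData A f N) {q r : ValueIndex f N}
    (ha : (q.2.1 : ℕ) = r.2.1) (hz : (q.2.2 : ℂ) = r.2.2) : q = r := by
  obtain ⟨i, a, z, hz1⟩ := q
  obtain ⟨j, b, w, hw1⟩ := r
  dsimp only at ha hz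
  subst hz
  obtain rfl := h.eq_of_root ((mem_rootSet_iff_aeval (h.monic i)).mp hz1)
    ((mem_rootSet_iff_aeval (h.monic j)).mp hw1)
  obtain rfl := Fin.ext ha
  rfl

theorem IsModelData.exists_valueIndex (h : IsModelData A f N) (x : EigenIndex A) :
    ∃ q : ValueIndex f N, (q.2.1 : ℕ) = x.1.2 ∧ (q.2.2 : ℂ) = x.1.1 := by
  obtain ⟨i, hi⟩ := h.exists_root x.1.1 (Nat.zero_lt_of_lt x.2)
  exact ⟨⟨i, ⟨x.1.2, x.2.trans_le (h.mult_le i _ hi)⟩, ⟨x.1.1,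
    (mem_rootSet_iff_aeval (h.monic i)).mpr hi⟩⟩, rfl, rfl⟩

theorem polyEval_conj (c : CoeffIndex f N → ℝ) (i : Fin k) (j : Fin (N i)) (z : ℂ) :
    polyEval c i j (conj z) = conj (polyEval c i j z) := by
  simp [polyEval]

theorem IsModelData.valueMap_conj (h : IsModelData A f N) (c : CoeffIndex f N → ℝ)
    {q r : ValueIndex f N} (ha : (q.2.1 : ℕ) = r.2.1) (hz : (q.2.2 : ℂ) = conj (r.2.2 : ℂ)) :
    valueMap T c q = conj (valueMap T c r) := by
  obtain ⟨i, a, z, hz1⟩ := q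
  obtain ⟨j, b, w, hw1⟩ := r
  dsimp only at ha hz
  subst hz
  obtain rfl := h.eq_of_root ((mem_rootSet_iff_aeval (h.monic i)).mp hz1)
    (aeval_conj_eq_zero ((mem_rootSet_iff_aeval (h.monic j)).mp hw1))
  obtain rfl := Fin.ext ha
  simp [valueMap_apply, polyEval_conj]

/-- The physical projection of the model: a surjection onto `ℝ^n` with kernel the internal part
that turns multiplication by the roots into the action of `A`. -/
theorem IsModelData.exists_physical_map (h : IsModelData A f N) (hdiag : DiagonalizableOverC A)
    (hT : ∀ i, T i * (T i)ᵀ = 1) :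
    ∃ φ : (CoeffIndex f N → ℝ) →ₗ[ℝ] (Fin n → ℝ), Function.Surjective φ ∧
      (∀ c, φ c = 0 ↔ c ∈ intPart A T) ∧
      ∀ c c', (∀ q, valueMap T c' q = q.2.2 * valueMap T c q) → φ c' = A *ᵥ φ c := by
  classical
  obtain ⟨u, hu, hconj⟩ := exists_conj_eigenbasis A hdiag
  have : Finite (EigenIndex A) := Module.Finite.finite_basis u
  have := Fintype.ofFinite (EigenIndex A)
  choose r hra hrz using h.exists_valueIndex
  let F : (CoeffIndex f N → ℝ) →ₗ[ℝ] (Fin n → ℂ) :=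
    { toFun := fun c => ∑ x, valueMap T c (r x) • u x
      map_add' := fun c d => by simp [add_smul, Finset.sum_add_distrib]
      map_smul' := fun t c => by simp [Finset.smul_sum, mul_smul] }
  have hF : ∀ c, F c = ∑ x, valueMap T c (r x) • u x := fun c => rfl
  -- Conjugation permutes the eigenvectors and the values in the same way, so the combination is a
  -- real vector.
  have hstar : ∀ c, star (F c) = F c := by
    intro c
    let σ : Equiv.Perm (EigenIndex A) := Function.Involutive.toPerm (EigenIndex.conj A)
      (EigenIndex.conj_conj A)
    rw [hF, star_sum, ← Equiv.sum_comp σ]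
    refine Finset.sum_congr rfl fun x _ => ?_
    rw [star_smul, show σ x = EigenIndex.conj A x from rfl, ← hconj, EigenIndex.conj_conj]
    congr 1
    exact (h.valueMap_conj c (by rw [hra, hra]; rfl)
      (by rw [hrz, hrz]; simp [EigenIndex.conj])).symm
  let φ : (CoeffIndex f N → ℝ) →ₗ[ℝ] (Fin n → ℝ) := Complex.reLm.compLeft (Fin n) ∘ₗ F
  have hφ : ∀ c i, (φ c i : ℂ) = F c i := fun c i =>
    Complex.conj_eq_iff_re.mp (congrFun (hstar c) i)
  refine ⟨φ, fun x => ?_, fun c => ?_, fun c c' hc => ?_⟩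
  · let V : Fin n → ℂ := fun i => x i
    have hX : star V = V := by
      ext i
      simp [V]
    -- Coordinates of a real vector respect conjugation and may therefore be prescribed as physical
    -- values.
    have hrepr : ∀ y, u.repr V (EigenIndex.conj A y) = conj (u.repr V y) := by
      intro y
      have h1 : V = ∑ x, conj (u.repr V (EigenIndex.conj A x)) • u x := by
        let σ : Equiv.Perm (EigenIndex A) := Function.Involutive.toPerm (EigenIndex.conj A)
          (EigenIndex.conj_conj A)
        conv_lhs => rw [← hX, ← u.sum_repr V, star_sum, ← Equiv.sum_comp σ]
        refine Finset.sum_congr rfl fun x _ => ?_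
        rw [star_smul, show σ x = EigenIndex.conj A x from rfl, ← hconj, EigenIndex.conj_conj]
        rfl
      have h2 := congrArg (fun v => u.repr v y) h1
      rw [u.repr_sum_self] at h2
      rw [h2, Complex.conj_conj]
    obtain ⟨c, hc⟩ := exists_valueMap_eq (N := N) h.monic h.irreducible hT
      (fun _ a z => if ha : (a : ℕ) < mult A z then u.repr V ⟨(z, a), ha⟩ else 0)
      (fun i a z _ => by
        by_cases ha : (a : ℕ) < mult A z
        · have ha' : (a : ℕ) < mult A (conj z) := by rwa [mult_conj]
          rw [dif_pos ha, dif_pos ha']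
          exact hrepr ⟨(z, a), ha⟩
        · have ha' : ¬ (a : ℕ) < mult A (conj z) := by rwa [mult_conj]
          rw [dif_neg ha, dif_neg ha', map_zero])
    refine ⟨c, ?_⟩
    have h1 : F c = V := by
      rw [hF, ← u.sum_repr V]
      refine Finset.sum_congr rfl fun y _ => ?_
      have hy : ((r y).2.1 : ℕ) < mult A (r y).2.2 := by rw [hra, hrz]; exact y.2
      rw [hc, dif_pos hy]
      congr 2
      exact Subtype.ext (Prod.ext (hrz y) (hra y))
    ext i
    have h2 := hφ c i
    rw [h1] at h2
    exact Complex.ofReal_injective h2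
  · have h1 : φ c = 0 ↔ F c = 0 := by
      simp only [funext_iff, ← hφ, Pi.zero_apply, Complex.ofReal_eq_zero]
    rw [h1]
    constructor
    · intro h2 q hq
      have h3 := (Fintype.linearIndependent_iff.mp u.linearIndependent) _ h2
        ⟨((q.2.2 : ℂ), (q.2.1 : ℕ)), hq⟩
      rwa [h.valueIndex_ext (q := r _) (r := q) (hra _) (hrz _)] at h3
    · intro h2
      rw [hF]
      refine Finset.sum_eq_zero fun x _ => ?_
      have hx : ((r x).2.1 : ℕ) < mult A (r x).2.2 := by rw [hra, hrz]; exact x.2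
      rw [h2 (r x) hx, zero_smul]
  · have h1 : F c' = complexify A *ᵥ F c := by
      rw [hF, hF, mulVec_sum]
      refine Finset.sum_congr rfl fun x _ => ?_
      rw [mulVec_smul, hu, hc, hrz, smul_smul, mul_comm]
    ext i
    have h2 := congrFun h1 i
    rw [← hφ] at h2
    have h3 : (complexify A *ᵥ F c) i = ((A *ᵥ φ c) i : ℝ) := by
      simp [mulVec, dotProduct, complexify, ← hφ]
    rw [h3] at h2
    exact_mod_cast h2

/-! ### Arithmetic properties of the model -/

theorem isAlgebraic_of_aeval_eq_zero {p : ℤ[X]} (hp : p.Monic) {z : ℂ} (hz : aeval z p = 0) :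
    IsAlgebraic ℚ z :=
  IsAlgebraic.extendScalars (R := ℤ) Int.cast_injective ⟨p, hp.ne_zero, hz⟩

/-- An integral vector vanishes if for each `i` one of its values for `f i` does. -/
theorem eq_zero_of_valueMap_eq_zero (hf : ∀ i, (f i).Monic)
    (hirr : ∀ i, Irreducible ((f i).map (Int.castRingHom ℚ)))
    (hT : ∀ (i : Fin k) (a : Fin (N i)) (c : Fin (N i) → ℂ), (∀ j, IsAlgebraic ℚ (c j)) →
      ∑ j, (T i a j : ℂ) * c j = 0 → c = 0) (c : CoeffIndex f N → ℤ)
    (h : ∀ i, ∃ q : Fin (N i) × (f i).rootSet ℂ, valueMap T (intVec c) ⟨i, q⟩ = 0) : c = 0 := by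
  ext ⟨i, j, e⟩
  obtain ⟨⟨a, z, hz⟩, hq⟩ := h i
  have hz' := (mem_rootSet_iff_aeval (hf i)).mp hz
  have hza : IsAlgebraic ℚ z := isAlgebraic_of_aeval_eq_zero (hf i) hz'
  have h1 := hT i a (fun j => polyEval (intVec c) i j z) (fun j => isAlgebraic_sum _ _ fun e _ => by
    refine IsAlgebraic.mul ?_ (hza.pow _)
    simpa using isAlgebraic_intCast (R := ℚ) (A := ℂ) (c ⟨i, j, e⟩)) hq
  have h2 := eq_zero_of_sum_pow_eq_zero (hf i) (hirr i) hz' rfl (fun e => c ⟨i, j, e⟩)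
    (by simpa [polyEval] using congrFun h1 j)
  exact congrFun h2 e

/-- An integral functional that vanishes on the physical part is zero. -/
theorem IsModelData.functional_eq_zero (h : IsModelData A f N) (hTo : ∀ i, T i * (T i)ᵀ = 1)
    (hT : ∀ (i : Fin k) (a : Fin (N i)) (c : Fin (N i) → ℂ), (∀ j, IsAlgebraic ℚ (c j)) →
      ∑ j, (T i a j : ℂ) * c j = 0 → c = 0)
    (w : (CoeffIndex f N → ℝ) →ₗ[ℝ] ℝ) (hw : ∀ c : CoeffIndex f N → ℤ, ∃ z : ℤ, w (intVec c) = z)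
    (hwp : ∀ c ∈ physPart A T, w c = 0) : w = 0 := by
  classical
  choose v hv using fun x => hw (Pi.single x 1)
  have hv' : ∀ x, w (Pi.single x 1) = v x := fun x => by
    rw [← hv]
    congr 1
    ext y
    simp [Pi.single_apply]
  have hsum : ∀ c, w c = ∑ x, c x * v x := fun c => by
    conv_lhs => rw [pi_eq_sum_univ' c, map_sum]
    refine Finset.sum_congr rfl fun x _ => ?_
    rw [map_smul, smul_eq_mul, ← hv']
  suffices hv0 : ∀ x, v x = 0 by
    ext1 x
    ext
    simp [hv', hv0]
  rintro ⟨i, j, e⟩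
  obtain ⟨z₀, hz₀, hm⟩ := h.exists_mult_pos i
  have hN : 0 < N i := hm.trans_le (h.mult_le i z₀ hz₀)
  let o : Fin (N i) := ⟨0, hN⟩
  -- Up to a factor, the polynomial that among the roots of `f i` is nonzero only at `z₀`.
  let g : ℂ[X] := (f i).map (Int.castRingHom ℂ) /ₘ (X - C z₀)
  have hroot : ((f i).map (Int.castRingHom ℂ)).IsRoot z₀ := by
    rw [IsRoot, ← algebraMap_int_eq, eval_map_algebraMap, hz₀]
  have hg : ∀ z, z ≠ z₀ → aeval z (f i) = 0 → g.eval z = 0 := by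
    intro z hne hz
    have h1 := congrArg (fun p => p.eval z) (mul_divByMonic_eq_iff_isRoot.mpr hroot)
    simp only [eval_mul, eval_sub, eval_X, eval_C] at h1
    have h2 : ((f i).map (Int.castRingHom ℂ)).eval z = 0 := by
      rw [← algebraMap_int_eq, eval_map_algebraMap, hz]
    rw [h2] at h1
    exact (mul_eq_zero.mp h1).resolve_left (sub_ne_zero.mpr hne)
  have hdeg : (f i).natDegree ≠ 0 := by
    intro h0
    exact (h.irreducible i).natDegree_pos.ne' (by rwa [(h.monic i).natDegree_map])
  have hgdeg : g.natDegree < (f i).natDegree := by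
    rw [natDegree_divByMonic _ (monic_X_sub_C z₀), (h.monic i).natDegree_map, natDegree_X_sub_C]
    omega
  have hgeval : ∀ z, g.eval z = ∑ e : Fin (f i).natDegree, g.coeff e * z ^ (e : ℕ) := fun z => by
    rw [eval_eq_sum_range' hgdeg, ← Fin.sum_univ_eq_sum_range (fun e => g.coeff e * z ^ e)]
  -- A real vector made from row `o` of `T i` and the real part of `ζ * g`. Orthogonality of the
  -- rows leaves values only in row `o`, and there only at `z₀` and its conjugate. These are
  -- physical because `0 < mult A z₀`.
  let c : ℂ → CoeffIndex f N → ℝ := fun ζ x =>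
    if hx : x.1 = i then T i o (hx ▸ x.2.1) * (2 * (ζ * g.coeff x.2.2).re) else 0
  have hc : ∀ ζ j e, c ζ ⟨i, j, e⟩ = T i o j * (2 * (ζ * g.coeff e).re) := fun ζ j e => by
    simp [c]
  have hc0 : ∀ ζ l j e, l ≠ i → c ζ ⟨l, j, e⟩ = 0 := fun ζ l j e hl => by
    simp [c, hl]
  have hpoly : ∀ ζ j z, polyEval (c ζ) i j z =
      T i o j * (ζ * g.eval z + conj (ζ * g.eval (conj z))) := by
    intro ζ j z
    simp only [polyEval, hc, hgeval, map_mul, map_sum, map_pow, Complex.conj_conj]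
    simp only [Finset.mul_sum, ← Finset.sum_add_distrib]
    refine Finset.sum_congr rfl fun e _ => ?_
    have h2 : ((2 * (ζ * g.coeff e).re : ℝ) : ℂ) = ζ * g.coeff e + conj ζ * conj (g.coeff e) := by
      rw [← map_mul, Complex.add_conj]
    rw [Complex.ofReal_mul, h2]
    ring
  have hmem : ∀ ζ, c ζ ∈ physPart A T := by
    rintro ζ ⟨l, a, z, hz⟩ hq
    have hz' := (mem_rootSet_iff_aeval (h.monic l)).mp hz
    by_cases hl : l = i
    · subst hl
      rw [valueMap_apply]
      simp only [hpoly, ← mul_assoc, ← Finset.sum_mul]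
      by_cases ha : a = o
      · have hz0 : ¬ 0 < mult A z := by
          subst ha
          exact hq
        have h1 : z ≠ z₀ := by
          rintro rfl
          exact hz0 hm
        have h2 : conj z ≠ z₀ := by
          rintro rfl
          exact hz0 (by rwa [mult_conj] at hm)
        rw [hg z h1 hz', hg _ h2 (aeval_conj_eq_zero hz')]
        simp
      · have h3 := congrFun (congrFun (hTo l) a) o
        rw [mul_apply, one_apply_ne ha] at h3
        have h4 : (∑ j, (T l a j : ℂ) * (T l o j : ℂ)) = 0 := by
          have h5 := congrArg (fun r : ℝ => (r : ℂ)) h3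
          simpa using h5
        rw [h4, zero_mul]
    · rw [valueMap_apply]
      refine Finset.sum_eq_zero fun j _ => ?_
      simp [polyEval, hc0 _ _ _ _ hl]
  have hzalg : IsAlgebraic ℚ z₀ := isAlgebraic_of_aeval_eq_zero (h.monic i) hz₀
  let s : Fin (N i) → ℂ := fun j => ∑ e : Fin (f i).natDegree, (v ⟨i, j, e⟩ : ℂ) * g.coeff e
  have hs : ∀ ζ : ℂ, (ζ * ∑ j, (T i o j : ℂ) * s j).re = 0 := by
    intro ζ
    have h1 := hwp _ (hmem ζ)
    rw [hsum, Fintype.sum_sigma, Finset.sum_eq_single i, Fintype.sum_prod_type] at h1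
    · have h2 : ∑ j, ∑ e, c ζ ⟨i, j, e⟩ * (v ⟨i, j, e⟩ : ℝ) =
          2 * (ζ * ∑ j, (T i o j : ℂ) * s j).re := by
        simp only [hc, s, Finset.mul_sum, Complex.re_sum]
        refine Finset.sum_congr rfl fun j _ => Finset.sum_congr rfl fun e _ => ?_
        have h3 : ζ * ((T i o j : ℂ) * ((v ⟨i, j, e⟩ : ℂ) * g.coeff e)) =
            ((T i o j * v ⟨i, j, e⟩ : ℝ) : ℂ) * (ζ * g.coeff e) := by
          push_cast
          ring
        rw [h3, Complex.re_ofReal_mul]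
        ring
      rw [h2] at h1
      simpa using h1
    · intro l _ hl
      exact Finset.sum_eq_zero fun x _ => by rw [hc0 ζ l _ _ hl, zero_mul]
    · simp
  -- Taking for `ζ` the conjugate of the sum turns the real part into its squared modulus.
  have hs0 : ∑ j, (T i o j : ℂ) * s j = 0 := by
    have h1 := hs (conj (∑ j, (T i o j : ℂ) * s j))
    rw [mul_comm, Complex.mul_conj, Complex.ofReal_re] at h1
    exact Complex.normSq_eq_zero.mp h1
  have hs1 := hT i o s (fun j => isAlgebraic_sum _ _ fun e _ => by
    refine IsAlgebraic.mul ?_ ?_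
    · simpa using isAlgebraic_intCast (R := ℚ) (A := ℂ) (v ⟨i, j, e⟩)
    · simp only [g, coeff_divByMonic_X_sub_C]
      refine isAlgebraic_sum _ _ fun l _ => (hzalg.pow _).mul ?_
      simpa using isAlgebraic_intCast (R := ℚ) (A := ℂ) ((f i).coeff l)) hs0
  exact congrFun (eq_zero_of_sum_coeff_divByMonic (h.monic i) (h.irreducible i) hz₀ rfl
    (fun e => v ⟨i, j, e⟩) (congrFun hs1 j)) e

end CutProject

namespace CutProject

open Polynomial Matrix ComplexConjugate

variable {n : ℕ} {A : Matrix (Fin n) (Fin n) ℝ} {k : ℕ} {f : Fin k → ℤ[X]} {N : Fin k → ℕ}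

/-! ### The self-similar cut-and-project set of the model -/

/-- The preimage of the open unit ball under an injective linear map is a window. -/
theorem isWindow_preimage_ball {m : ℕ} {F : Type*} [NormedAddCommGroup F] [NormedSpace ℝ F]
    (Φ : (Fin m → ℝ) →ₗ[ℝ] F) (hΦ : ∀ y, Φ y = 0 → y = 0) :
    IsWindow (Φ ⁻¹' Metric.ball 0 1) := by
  have hopen : IsOpen (Φ ⁻¹' Metric.ball 0 1) :=
    Metric.isOpen_ball.preimage Φ.continuous_of_finiteDimensional
  refine ⟨?_, by rw [hopen.interior_eq], ⟨0, subset_closure (by simp)⟩⟩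
  obtain ⟨K, -, hK⟩ := Φ.exists_antilipschitzWith (LinearMap.ker_eq_bot'.mpr hΦ)
  exact hK.isBounded_preimage Metric.isBounded_ball

theorem IsModelData.admitsSelfSimilarSet (h : IsModelData A f N) (hdiag : DiagonalizableOverC A)
    (hn : 1 ≤ n) (hk : 0 < k) : AdmitsSelfSimilarSet A (∑ i, N i * (f i).natDegree) := by
  classical
  choose T hTo hT using fun i => exists_orthogonal_independent_rows (N i)
  obtain ⟨φ, hφsurj, hφker, hφA⟩ := h.exists_physical_map hdiag hTo
  have hcompl := isCompl_parts (A := A) h.monic h.irreducible hTo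
  let m := Module.finrank ℝ (intPart (f := f) A T)
  let e : intPart (f := f) A T ≃ₗ[ℝ] (Fin m → ℝ) := LinearEquiv.ofFinrankEq _ _ (by simp [m])
  let ψ := e.toLinearMap ∘ₗ (intPart (f := f) A T).projectionOnto (physPart A T) hcompl
  have hψ0 : ∀ c, ψ c = 0 ↔ c ∈ physPart A T := fun c => by
    simp [ψ, Submodule.projectionOnto_apply_eq_zero_iff]
  have hcard : Fintype.card (CoeffIndex f N) = ∑ i, N i * (f i).natDegree := by
    simp [CoeffIndex]
  have hdim : Fintype.card (CoeffIndex f N) = n + m := by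
    have h1 := φ.finrank_range_add_finrank_ker
    have h2 : LinearMap.ker φ = intPart A T := by
      ext c
      exact hφker c
    rw [LinearMap.range_eq_top.mpr hφsurj, h2, finrank_top] at h1
    simpa [m] using h1.symm
  have hφ0 : ∀ c : CoeffIndex f N → ℤ, φ (intVec c) = 0 → c = 0 := by
    intro c hc
    refine eq_zero_of_valueMap_eq_zero h.monic h.irreducible hT c fun i => ?_
    obtain ⟨z, hz, hm⟩ := h.exists_mult_pos i
    exact ⟨(⟨0, hm.trans_le (h.mult_le i z hz)⟩, ⟨z, (mem_rootSet_iff_aeval (h.monic i)).mpr hz⟩),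
      (hφker _).mp hc _ hm⟩
  have hψ1 : ∀ c : CoeffIndex f N → ℤ, ψ (intVec c) = 0 → c = 0 := by
    intro c hc
    refine eq_zero_of_valueMap_eq_zero h.monic h.irreducible hT c fun i => ?_
    obtain ⟨z, hz, hm⟩ := h.exists_mult_lt i
    -- Numbers below `mult A z` are physical, so this is the first internal value at `z`.
    refine ⟨(⟨mult A z, hm⟩, ⟨z, (mem_rootSet_iff_aeval (h.monic i)).mpr hz⟩),
      (hψ0 _).mp hc _ (by simp [IsPhysical])⟩
  -- With a trivial internal space `ψ` would vanish on a nonzero lattice vector, such as the vector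
  -- of ones; `0 < k` ensures that it is nonzero.
  have hm : 1 ≤ m := by
    by_contra hcon
    have hm0 : m = 0 := by omega
    have hE : IsEmpty (Fin m) := by rw [hm0]; infer_instance
    let i : Fin k := ⟨0, hk⟩
    obtain ⟨z, hz, hlt⟩ := h.exists_mult_lt i
    have hd : 0 < (f i).natDegree := by
      have := (h.irreducible i).natDegree_pos
      rwa [(h.monic i).natDegree_map] at this
    have h1 := hψ1 (fun _ => 1) (Subsingleton.elim _ _)
    have h2 := congrFun h1 ⟨i, ⟨0, Nat.zero_lt_of_lt hlt⟩, ⟨0, hd⟩⟩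
    simp at h2
  let Φ : (Fin m → ℝ) →ₗ[ℝ] (ValueIndex f N → ℂ) :=
    valueMap T ∘ₗ (intPart (f := f) A T).subtype ∘ₗ e.symm.toLinearMap
  have hΦ : ∀ y, Φ y = 0 → y = 0 := fun y hy => by
    have := valueMap_injective h.monic h.irreducible hTo _ hy
    simpa using this
  -- A vector differs from its internal component by an element of `physPart`, whose internal values
  -- vanish.
  have hΦψ : ∀ c q, ¬ IsPhysical A q → Φ (ψ c) q = valueMap T c q := by
    intro c q hq
    have h1 := Submodule.sub_projection_mem hcompl c q hq
    rw [map_sub, Pi.sub_apply, sub_eq_zero] at h1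
    rw [h1]
    simp [Φ, ψ, Submodule.coe_projectionOnto_apply]
  have hΦψ0 : ∀ c q, IsPhysical A q → Φ (ψ c) q = 0 := fun c q hq =>
    (e.symm (ψ c)).2 q hq
  rw [← hcard]
  refine admitsSelfSimilarSet_of_linear_data A hn hm hdim φ ψ (fun c h1 h2 => ?_) hφ0 hψ1
    (fun w hw hwp => ?_) (Φ ⁻¹' Metric.ball 0 1) (isWindow_preimage_ball Φ hΦ) fun c hc => ?_
  · exact (Submodule.disjoint_def.mp hcompl.disjoint) c ((hφker c).mp h1) ((hψ0 c).mp h2)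
  · exact h.functional_eq_zero hTo hT w hw fun c hc => hwp c ((hψ0 c).mpr hc)
  · obtain ⟨c', hc'⟩ := exists_valueMap_mul_root (T := T) h.monic h.irreducible c
    refine ⟨c', hφA _ _ hc', ?_⟩
    rw [Set.mem_preimage, mem_ball_zero_iff, pi_norm_lt_iff one_pos] at hc ⊢
    intro q
    by_cases hq : IsPhysical A q
    · rw [hΦψ0 _ _ hq, norm_zero]
      exact one_pos
    · rw [hΦψ _ _ hq, hc', norm_mul]
      have h1 := hc q
      rw [hΦψ _ _ hq] at h1
      refine lt_of_le_of_lt (mul_le_of_le_one_left (norm_nonneg _) ?_) h1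
      exact h.norm_le_one q.1 q.2.2 ((mem_rootSet_iff_aeval (h.monic _)).mp q.2.2.2)
        ((not_lt.mp hq).trans_lt q.2.1.2)

end CutProject

namespace CutProject

open Polynomial Matrix ComplexConjugate

variable {n : ℕ} {A : Matrix (Fin n) (Fin n) ℝ}

/-! ### The minimal polynomial over the rationals -/

theorem aeval_mulVec_of_eigenvector {M : Matrix (Fin n) (Fin n) ℂ} {z : ℂ} {x : Fin n → ℂ}
    (h : M *ᵥ x = z • x) (p : ℚ[X]) : aeval M p *ᵥ x = aeval z p • x := by
  induction p using Polynomial.induction_on' with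
  | add p q hp hq => rw [map_add, map_add, add_mulVec, add_smul, hp, hq]
  | monomial e a =>
    rw [aeval_monomial, aeval_monomial, ← mulVec_mulVec]
    have h1 : ∀ e : ℕ, M ^ e *ᵥ x = z ^ e • x := by
      intro e
      induction e with
      | zero => simp
      | succ e ih => rw [pow_succ, ← mulVec_mulVec, h, mulVec_smul, ih, smul_smul, pow_succ']
    rw [h1, Algebra.algebraMap_eq_smul_one, smul_mulVec, one_mulVec, mul_smul,
      Algebra.algebraMap_eq_smul_one, smul_assoc, one_smul]

theorem complexify_aeval (A : Matrix (Fin n) (Fin n) ℝ) (p : ℚ[X]) :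
    complexify (aeval A p) = aeval (complexify A) p :=
  (aeval_algHom_apply (Complex.ofRealAm.restrictScalars ℚ).mapMatrix A p).symm

theorem aeval_eq_zero_iff (hdiag : DiagonalizableOverC A) (p : ℚ[X]) :
    aeval A p = 0 ↔ ∀ z, 0 < mult A z → aeval z p = 0 := by
  obtain ⟨u, hu⟩ := exists_eigenbasis A hdiag
  have h1 : aeval A p = 0 ↔ aeval (complexify A) p = 0 := by
    rw [← complexify_aeval]
    refine ⟨fun h => by rw [h]; ext; simp [complexify], fun h => ?_⟩
    ext i j
    have := congrFun (congrFun h i) j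
    simpa [complexify] using this
  rw [h1]
  constructor
  · intro h z hz
    have h2 := aeval_mulVec_of_eigenvector (hu ⟨(z, 0), hz⟩) p
    rw [h, zero_mulVec, eq_comm, smul_eq_zero] at h2
    exact h2.resolve_right (u.ne_zero _)
  · intro h
    have h2 : toLin' (aeval (complexify A) p) = 0 := by
      refine u.ext fun x => ?_
      rw [toLin'_apply, aeval_mulVec_of_eigenvector (hu x), h _ (Nat.zero_lt_of_lt x.2)]
      simp
    exact (LinearEquiv.map_eq_zero_iff _).mp h2

theorem isCoprime_of_irreducible_of_ne {p q : ℚ[X]} (hp : Irreducible p) (hq : Irreducible q)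
    (hpm : p.Monic) (hqm : q.Monic) (hne : p ≠ q) : IsCoprime p q := by
  rw [hp.coprime_iff_not_dvd]
  intro hdvd
  exact hne (eq_of_monic_of_associated hpm hqm (hp.associated_of_dvd hq hdvd))

theorem minpoly_rat_eq_map {z : ℂ} (hz : IsIntegral ℤ z) :
    minpoly ℚ z = (minpoly ℤ z).map (Int.castRingHom ℚ) :=
  minpoly.isIntegrallyClosed_eq_field_fractions' ℚ hz

/-- The minimal polynomial of `A` is the product of the minimal polynomials of its eigenvalues. -/
theorem minpoly_eq_prod (hdiag : DiagonalizableOverC A) (hP1 : PropertyP1 A) :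
    ∃ S : Finset ℤ[X], (∀ g ∈ S, ∃ z, 0 < mult A z ∧ g = minpoly ℤ z) ∧
      minpoly ℚ A = ∏ g ∈ S, g.map (Int.castRingHom ℚ) := by
  classical
  have hint : ∀ z, 0 < mult A z → IsIntegral ℤ z := fun z hz =>
    hP1 z ((mult_pos_iff A z).mp hz)
  let S : Finset ℤ[X] := (complexify A).charpoly.roots.toFinset.image fun z => minpoly ℤ z
  have hroots : ∀ z, z ∈ (complexify A).charpoly.roots.toFinset ↔ 0 < mult A z := fun z => by
    rw [Multiset.mem_toFinset, ← Multiset.count_pos, count_roots, mult]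
  have hS : ∀ g ∈ S, ∃ z, 0 < mult A z ∧ g = minpoly ℤ z := by
    intro g hg
    obtain ⟨z, hz, rfl⟩ := Finset.mem_image.mp hg
    exact ⟨z, (hroots z).mp hz, rfl⟩
  refine ⟨S, hS, ?_⟩
  have hmonic : (∏ g ∈ S, g.map (Int.castRingHom ℚ)).Monic := by
    refine monic_prod_of_monic _ _ fun g hg => ?_
    obtain ⟨z, hz, rfl⟩ := hS g hg
    exact (minpoly.monic (hint z hz)).map _
  have hzero : aeval A (∏ g ∈ S, g.map (Int.castRingHom ℚ)) = 0 := by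
    rw [aeval_eq_zero_iff hdiag]
    intro z hz
    rw [map_prod]
    refine Finset.prod_eq_zero (Finset.mem_image_of_mem _ ((hroots z).mpr hz)) ?_
    rw [← minpoly_rat_eq_map (hint z hz), minpoly.aeval]
  have hA : IsIntegral ℚ A := ⟨_, hmonic, hzero⟩
  refine eq_of_monic_of_associated (minpoly.monic hA) hmonic
    (associated_of_dvd_dvd (minpoly.dvd _ _ hzero) ?_)
  refine Finset.prod_dvd_of_coprime ?_ fun g hg => ?_
  · intro g hg g' hg' hne
    obtain ⟨z, hz, rfl⟩ := hS g hg
    obtain ⟨w, hw, rfl⟩ := hS g' hg'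
    have h1 : minpoly ℚ z ≠ minpoly ℚ w := by
      rw [minpoly_rat_eq_map (hint z hz), minpoly_rat_eq_map (hint w hw)]
      exact fun h => hne (map_injective _ Int.cast_injective h)
    have h2 := isCoprime_of_irreducible_of_ne (minpoly.irreducible (hint z hz).tower_top)
      (minpoly.irreducible (hint w hw).tower_top) (minpoly.monic (hint z hz).tower_top)
      (minpoly.monic (hint w hw).tower_top) h1
    rwa [minpoly_rat_eq_map (hint z hz), minpoly_rat_eq_map (hint w hw)] at h2
  · obtain ⟨z, hz, rfl⟩ := hS g hg
    rw [← minpoly_rat_eq_map (hint z hz)]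
    exact minpoly.dvd _ _ ((aeval_eq_zero_iff hdiag _).mp (minpoly.aeval ℚ A) z hz)

theorem exists_minpoly_factorization (hdiag : DiagonalizableOverC A) (hP1 : PropertyP1 A) :
    ∃ (k : ℕ) (f : Fin k → ℤ[X]), IsMinpolyFactorization A f := by
  obtain ⟨S, hS, hprod⟩ := minpoly_eq_prod hdiag hP1
  have hint : ∀ z, 0 < mult A z → IsIntegral ℤ z := fun z hz =>
    hP1 z ((mult_pos_iff A z).mp hz)
  let e := S.equivFin.symm
  refine ⟨S.card, fun i => (e i : ℤ[X]), fun i j h => e.injective (Subtype.ext h), fun i => ?_,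
    fun i => ?_, ?_⟩
  · obtain ⟨z, hz, h⟩ := hS _ (e i).2
    dsimp only
    rw [h]
    exact minpoly.monic (hint z hz)
  · obtain ⟨z, hz, h⟩ := hS _ (e i).2
    dsimp only
    rw [h, ← minpoly_rat_eq_map (hint z hz)]
    exact minpoly.irreducible (hint z hz).tower_top
  · rw [hprod, Equiv.prod_comp e fun g : S => (g : ℤ[X]).map (Int.castRingHom ℚ)]
    exact (Finset.prod_coe_sort S fun g => g.map (Int.castRingHom ℚ)).symm

section Factorization

variable {k : ℕ} {f : Fin k → ℤ[X]}

theorem IsMinpolyFactorization.exists_root (h : IsMinpolyFactorization A f)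
    (hdiag : DiagonalizableOverC A) {z : ℂ} (hz : 0 < mult A z) : ∃ i, aeval z (f i) = 0 := by
  have h1 := (aeval_eq_zero_iff hdiag _).mp (minpoly.aeval ℚ A) z hz
  rw [h.2.2.2, map_prod, Finset.prod_eq_zero_iff] at h1
  obtain ⟨i, -, hi⟩ := h1
  rw [← algebraMap_int_eq, aeval_map_algebraMap] at hi
  exact ⟨i, hi⟩

theorem IsMinpolyFactorization.dvd_minpoly (h : IsMinpolyFactorization A f) (i : Fin k) :
    (f i).map (Int.castRingHom ℚ) ∣ minpoly ℚ A := by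
  rw [h.2.2.2]
  exact Finset.dvd_prod_of_mem (fun i => (f i).map (Int.castRingHom ℚ)) (Finset.mem_univ i)

/-- An irreducible divisor of a product of minimal polynomials of eigenvalues is one of them. -/
theorem IsMinpolyFactorization.exists_mult_pos (h : IsMinpolyFactorization A f)
    (hdiag : DiagonalizableOverC A) (hP1 : PropertyP1 A) (i : Fin k) :
    ∃ z, aeval z (f i) = 0 ∧ 0 < mult A z := by
  obtain ⟨S, hS, hprod⟩ := minpoly_eq_prod hdiag hP1
  obtain ⟨g, hg, hdvd⟩ := ((h.2.2.1 i).prime.dvd_finsetProd_iff _).mp (hprod ▸ h.dvd_minpoly i)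
  obtain ⟨z, hz, rfl⟩ := hS g hg
  have hint := hP1 z ((mult_pos_iff A z).mp hz)
  rw [← minpoly_rat_eq_map hint] at hdvd
  have h1 := eq_of_monic_of_associated ((h.2.1 i).map _) (minpoly.monic hint.tower_top)
    ((h.2.2.1 i).associated_of_dvd (minpoly.irreducible hint.tower_top) hdvd)
  refine ⟨z, ?_, hz⟩
  have h2 := minpoly.aeval ℚ z
  rwa [← h1, ← algebraMap_int_eq, aeval_map_algebraMap] at h2

end Factorization

/-! ### Largest and smallest multiplicities -/

theorem finite_mult_image (A : Matrix (Fin n) (Fin n) ℝ) (g : ℤ[X]) :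
    (mult A '' g.rootSet ℂ).Finite :=
  (g.rootSet_finite ℂ).image _

theorem mult_le_maxMult {g : ℤ[X]} (hg : g.Monic) {z : ℂ} (hz : aeval z g = 0) :
    mult A z ≤ maxMult A g :=
  le_csSup (finite_mult_image A g).bddAbove ⟨z, (mem_rootSet_iff_aeval hg).mpr hz, rfl⟩

theorem minMult_le_mult {g : ℤ[X]} (hg : g.Monic) {z : ℂ} (hz : aeval z g = 0) :
    minMult A g ≤ mult A z :=
  Nat.sInf_le ⟨z, (mem_rootSet_iff_aeval hg).mpr hz, rfl⟩

theorem exists_mult_eq_maxMult (A : Matrix (Fin n) (Fin n) ℝ) {g : ℤ[X]} (hg : g.Monic) {z : ℂ}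
    (hz : aeval z g = 0) : ∃ w, aeval w g = 0 ∧ mult A w = maxMult A g := by
  obtain ⟨w, hw, h⟩ := Nat.sSup_mem (s := mult A '' g.rootSet ℂ)
    ⟨_, z, (mem_rootSet_iff_aeval hg).mpr hz, rfl⟩ (finite_mult_image A g).bddAbove
  exact ⟨w, (mem_rootSet_iff_aeval hg).mp hw, h⟩

theorem exists_mult_eq_minMult (A : Matrix (Fin n) (Fin n) ℝ) {g : ℤ[X]} (hg : g.Monic) {z : ℂ}
    (hz : aeval z g = 0) : ∃ w, aeval w g = 0 ∧ mult A w = minMult A g := by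
  obtain ⟨w, hw, h⟩ := Nat.sInf_mem (s := mult A '' g.rootSet ℂ)
    ⟨_, z, (mem_rootSet_iff_aeval hg).mpr hz, rfl⟩
  exact ⟨w, (mem_rootSet_iff_aeval hg).mp hw, h⟩

open Classical in
/-- The number of copies of the factor `g` in the minimal lattice. -/
noncomputable def factorCopies (A : Matrix (Fin n) (Fin n) ℝ) (g : ℤ[X]) : ℕ :=
  if IsCyclotomicPoly g ∧ ¬ minMult A g < maxMult A g then maxMult A g + 1 else maxMult A g

theorem factorDim_eq (A : Matrix (Fin n) (Fin n) ℝ) (g : ℤ[X]) :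
    factorDim A g = factorCopies A g * g.natDegree := by
  unfold factorDim factorCopies
  split_ifs <;> tauto

theorem maxMult_le_factorCopies (A : Matrix (Fin n) (Fin n) ℝ) (g : ℤ[X]) :
    maxMult A g ≤ factorCopies A g := by
  unfold factorCopies
  split_ifs <;> omega

/-! ### Kronecker's theorem and the data of the model -/

/-- An irreducible monic integral polynomial other than `X` all of whose roots lie in the closed
unit disc is cyclotomic. -/
theorem isCyclotomicPoly_of_norm_le_one {g : ℤ[X]} (hg : g.Monic)
    (hirr : Irreducible (g.map (Int.castRingHom ℚ))) {z : ℂ} (hz : aeval z g = 0) (hz0 : z ≠ 0)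
    (h : ∀ w : ℂ, aeval w g = 0 → ‖w‖ ≤ 1) : IsCyclotomicPoly g := by
  have hroots : ∀ w ∈ (g.map (Int.castRingHom ℂ)).roots, aeval w g = 0 := fun w hw => by
    have := isRoot_of_mem_roots hw
    rwa [IsRoot, ← algebraMap_int_eq, eval_map_algebraMap] at this
  have hM : (g.map (Int.castRingHom ℂ)).mahlerMeasure = 1 := by
    rw [mahlerMeasure_eq_leadingCoeff_mul_prod_roots, (hg.map _).leadingCoeff, norm_one, one_mul]
    refine Multiset.prod_eq_one fun x hx => ?_
    obtain ⟨w, hw, rfl⟩ := Multiset.mem_map.mp hx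
    exact max_eq_left (h w (hroots w hw))
  obtain ⟨r, hr, hprim⟩ := isPrimitiveRoot_of_mahlerMeasure_eq_one hM hz0
    (mem_aroots.mpr ⟨hg.ne_zero, hz⟩)
  refine ⟨r, hr, map_injective (Int.castRingHom ℚ) Int.cast_injective ?_⟩
  rw [cyclotomic_eq_minpoly hprim hr, ← minpoly_rat_eq_map ⟨g, hg, hz⟩, minpoly_eq_map hg hirr hz]

theorem norm_eq_one_of_isCyclotomicPoly {g : ℤ[X]} (h : IsCyclotomicPoly g) {z : ℂ}
    (hz : aeval z g = 0) : ‖z‖ = 1 := by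
  obtain ⟨r, hr, rfl⟩ := h
  have : NeZero (r : ℂ) := ⟨by exact_mod_cast hr.ne'⟩
  have h1 : (cyclotomic r ℂ).IsRoot z := by
    rw [IsRoot, ← map_cyclotomic_int, ← algebraMap_int_eq, eval_map_algebraMap, hz]
  exact IsPrimitiveRoot.norm'_eq_one (isRoot_cyclotomic_iff.mp h1) hr.ne'

theorem algConj_of_root {g : ℤ[X]} (hg : g.Monic) (hirr : Irreducible (g.map (Int.castRingHom ℚ)))
    {z w : ℂ} (hz : aeval z g = 0) (hw : aeval w g = 0) : AlgConj z w :=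
  ⟨isAlgebraic_of_aeval_eq_zero hg hz, by
    rw [IsConjRoot, minpoly_eq_map hg hirr hz, minpoly_eq_map hg hirr hw]⟩

theorem root_of_algConj {g : ℤ[X]} (hg : g.Monic) (hirr : Irreducible (g.map (Int.castRingHom ℚ)))
    {z w : ℂ} (hz : aeval z g = 0) (h : AlgConj z w) : aeval w g = 0 := by
  have h1 := minpoly.aeval ℚ w
  rwa [← show minpoly ℚ z = minpoly ℚ w from h.2, minpoly_eq_map hg hirr hz, ← algebraMap_int_eq,
    aeval_map_algebraMap] at h1

/-- Both halves of `𝔓2` enter. Strictness at a root outside the unit disc gives a root of smaller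
multiplicity; maximality there shows that roots of multiplicity below the number of copies lie in
the closed disc. Cyclotomic factors have all their roots on the unit circle. -/
theorem isModelData_of_propertyP (hA : A.det ≠ 0) (hdiag : DiagonalizableOverC A)
    (hP : PropertyP A) {k : ℕ} {f : Fin k → ℤ[X]} (h : IsMinpolyFactorization A f) :
    IsModelData A f fun i => factorCopies A (f i) := by
  have hmon := h.2.1
  have hirr := h.2.2.1
  have hpos := h.exists_mult_pos hdiag hP.1
  have hP2 : ∀ i w, aeval w (f i) = 0 → 1 < ‖w‖ →
      (∀ u, aeval u (f i) = 0 → mult A u ≤ mult A w) ∧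
      ∃ u, aeval u (f i) = 0 ∧ mult A u < mult A w := by
    intro i w hw hnorm
    obtain ⟨z, hz, hm⟩ := hpos i
    obtain ⟨-, h1, u, hu, h2⟩ := hP.2 w hnorm ⟨z, (mult_pos_iff A z).mp hm,
      algConj_of_root (hmon i) (hirr i) hz hw⟩
    exact ⟨fun u hu => h1 u (algConj_of_root (hmon i) (hirr i) hw hu), u,
      root_of_algConj (hmon i) (hirr i) hw hu, h2⟩
  refine ⟨hmon, hirr, h.1, fun z hz => h.exists_root hdiag hz, fun i z hz => ?_, hpos,
    fun i => ?_, fun i z hz hlt => ?_⟩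
  · exact (mult_le_maxMult (hmon i) hz).trans (maxMult_le_factorCopies A (f i))
  · obtain ⟨z, hz, hm⟩ := hpos i
    by_cases hc : IsCyclotomicPoly (f i)
    · by_cases hlt : minMult A (f i) < maxMult A (f i)
      · obtain ⟨w, hw, hwm⟩ := exists_mult_eq_minMult A (hmon i) hz
        exact ⟨w, hw, hwm ▸ hlt.trans_le (maxMult_le_factorCopies A (f i))⟩
      · refine ⟨z, hz, ?_⟩
        rw [factorCopies, if_pos ⟨hc, hlt⟩]
        exact Nat.lt_succ_of_le (mult_le_maxMult (hmon i) hz)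
    · have hz0 : z ≠ 0 := by
        rintro rfl
        rw [mult_pos_iff, spectrum.zero_mem_iff, Matrix.isUnit_iff_isUnit_det,
          isUnit_iff_ne_zero, not_not] at hm
        refine hA ?_
        have h1 : (complexify A).det = (A.det : ℂ) :=
          (RingHom.map_det (algebraMap ℝ ℂ) A).symm
        rw [h1] at hm
        exact_mod_cast hm
      obtain ⟨w, hw, hnorm⟩ : ∃ w : ℂ, aeval w (f i) = 0 ∧ 1 < ‖w‖ := by
        by_contra! hcon
        exact hc (isCyclotomicPoly_of_norm_le_one (hmon i) (hirr i) hz hz0 hcon)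
      obtain ⟨u, hu, hlt⟩ := (hP2 i w hw hnorm).2
      exact ⟨u, hu, hlt.trans_le ((mult_le_maxMult (hmon i) hw).trans
        (maxMult_le_factorCopies A (f i)))⟩
  · by_contra! hnorm
    have hc : ¬ IsCyclotomicPoly (f i) := fun hc =>
      hnorm.ne' (norm_eq_one_of_isCyclotomicPoly hc hz)
    rw [factorCopies, if_neg fun h => hc h.1] at hlt
    obtain ⟨w, hw, hwm⟩ := exists_mult_eq_maxMult A (hmon i) hz
    exact absurd ((hP2 i z hz hnorm).1 w hw) (by omega)

end CutProject

namespace CutProject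

open Polynomial Matrix ComplexConjugate

variable {n : ℕ} {A : Matrix (Fin n) (Fin n) ℝ}

/-! ### Divisibility of the characteristic polynomial of a self-similarity -/

/-- The roots of `g` are simple, and a common root with `G` would force `g ∣ G`. So all roots of `g`
have one and the same multiplicity in an integral polynomial. -/
theorem rootMultiplicity_pow_mul {g G : ℤ[X]} (hg : g.Monic)
    (hirr : Irreducible (g.map (Int.castRingHom ℚ))) (hG : ¬ g ∣ G) (c : ℕ) {z : ℂ}
    (hz : aeval z g = 0) :
    ((g ^ c * G).map (Int.castRingHom ℂ)).rootMultiplicity z = c := by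
  have hGz : aeval z G ≠ 0 := by
    intro h0
    refine hG ((map_dvd_map _ Int.cast_injective hg).mp (?_ : g.map (Int.castRingHom ℚ) ∣ _))
    rw [← minpoly_eq_map hg hirr hz]
    refine minpoly.dvd _ _ ?_
    rw [← algebraMap_int_eq, aeval_map_algebraMap, h0]
  have hG0 : G.map (Int.castRingHom ℂ) ≠ 0 := by
    intro h0
    rw [← eval_map_algebraMap, algebraMap_int_eq, h0, eval_zero] at hGz
    exact hGz rfl
  have hg0 : g.map (Int.castRingHom ℂ) ≠ 0 := (hg.map _).ne_zero
  have h1 : (g.map (Int.castRingHom ℂ)).rootMultiplicity z = 1 := by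
    have hsep : (g.map (Int.castRingHom ℂ)).Separable := by
      have := hirr.separable.map (f := algebraMap ℚ ℂ)
      rwa [Polynomial.map_map, show (algebraMap ℚ ℂ).comp (Int.castRingHom ℚ) =
        Int.castRingHom ℂ from RingHom.ext_int _ _] at this
    refine le_antisymm (rootMultiplicity_le_one_of_separable hsep z) ?_
    rw [Nat.one_le_iff_ne_zero, ← Nat.pos_iff_ne_zero, rootMultiplicity_pos hg0, IsRoot,
      ← algebraMap_int_eq, eval_map_algebraMap, hz]
  have h2 : (G.map (Int.castRingHom ℂ)).rootMultiplicity z = 0 := by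
    refine rootMultiplicity_eq_zero ?_
    rwa [IsRoot, ← algebraMap_int_eq, eval_map_algebraMap]
  rw [Polynomial.map_mul, Polynomial.map_pow,
    rootMultiplicity_mul (mul_ne_zero (pow_ne_zero c hg0) hG0), ← count_roots, roots_pow,
    Multiset.count_nsmul, count_roots, h1, h2, mul_one, add_zero]

theorem pow_factorCopies_dvd {m : ℕ} {D : Matrix (Fin m) (Fin m) ℝ} {χ : ℤ[X]} (hχ : χ.Monic)
    (hχA : χ.map (Int.castRingHom ℝ) = A.charpoly * D.charpoly)
    (hDA : ∀ G : ℤ[X], aeval D G = 0 → aeval A G = 0) {g : ℤ[X]} (hg : g.Monic)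
    (hirr : Irreducible (g.map (Int.castRingHom ℚ)))
    (hdvd : g.map (Int.castRingHom ℚ) ∣ minpoly ℚ A) :
    g ^ factorCopies A g ∣ χ := by
  have hdeg : 0 < g.degree := by
    have := hirr.natDegree_pos
    rw [hg.natDegree_map] at this
    exact natDegree_pos_iff_degree_pos.mp this
  obtain ⟨G, hG, hndvd⟩ :=
    (finiteMultiplicity_of_degree_pos_of_monic hdeg hg hχ.ne_zero).exists_eq_pow_mul_and_not_dvd
  set c := multiplicity g χ
  rw [hG]
  refine dvd_mul_of_dvd_left (pow_dvd_pow _ ?_) _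
  have hmult : ∀ z, aeval z g = 0 →
      mult A z + (D.charpoly.map (algebraMap ℝ ℂ)).rootMultiplicity z = c := by
    intro z hz
    rw [← rootMultiplicity_pow_mul hg hirr hndvd c hz, ← hG,
      show Int.castRingHom ℂ = (algebraMap ℝ ℂ).comp (Int.castRingHom ℝ) from
        RingHom.ext_int _ _, ← Polynomial.map_map, hχA, Polynomial.map_mul, rootMultiplicity_mul,
      mult, charpoly_complexify]
    exact mul_ne_zero ((charpoly_monic A).map _).ne_zero ((charpoly_monic D).map _).ne_zero
  obtain ⟨z, hz⟩ : ∃ z : ℂ, aeval z g = 0 := by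
    obtain ⟨z, hz⟩ := IsAlgClosed.exists_aeval_eq_zero ℂ g hdeg.ne'
    exact ⟨z, hz⟩
  have hmax : maxMult A g ≤ c := by
    obtain ⟨w, hw, h⟩ := exists_mult_eq_maxMult A hg hz
    have := hmult w hw
    omega
  rw [factorCopies]
  split_ifs with hc
  swap
  · exact hmax
  -- Now `c` is at most the multiplicity that all roots of `g` share in `A`, which leaves none of
  -- them for `D`. Hence `D.charpoly` divides `G`, and `G` annihilates `D` and then `A`, although
  -- `g` divides the minimal polynomial of `A` but not `G`.
  by_contra hlt
  have hD0 : ∀ w, aeval w g = 0 → ¬ (D.charpoly.map (algebraMap ℝ ℂ)).IsRoot w := by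
    intro w hw hroot
    have h1 := (rootMultiplicity_pos ((charpoly_monic D).map _).ne_zero).mpr hroot
    have h2 := hmult w hw
    have h3 := minMult_le_mult (A := A) hg hw
    have h4 := hc.2
    omega
  have hcop : IsCoprime D.charpoly (g.map (Int.castRingHom ℝ)) := by
    rw [isCoprime_iff_aeval_ne_zero_of_isAlgClosed ℝ ℂ]
    intro w
    by_cases hw : aeval w g = 0
    · left
      have := hD0 w hw
      rwa [IsRoot, eval_map_algebraMap] at this
    · right
      rwa [← algebraMap_int_eq, aeval_map_algebraMap]
  have hDG : D.charpoly ∣ G.map (Int.castRingHom ℝ) := by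
    refine (hcop.pow_right (n := c)).dvd_of_dvd_mul_left ?_
    rw [← Polynomial.map_pow, ← Polynomial.map_mul, ← hG, hχA]
    exact dvd_mul_left _ _
  have hGA : aeval A G = 0 := by
    refine hDA G ?_
    obtain ⟨q, hq⟩ := hDG
    rw [← aeval_map_algebraMap ℝ, algebraMap_int_eq, hq, map_mul, aeval_self_charpoly, zero_mul]
  refine hndvd ((map_dvd_map _ Int.cast_injective hg).mp (hdvd.trans (minpoly.dvd ℚ A ?_)))
  rw [← algebraMap_int_eq, aeval_map_algebraMap, hGA]

theorem sum_factorDim_le_natDegree {m : ℕ} {D : Matrix (Fin m) (Fin m) ℝ} {χ : ℤ[X]}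
    (hχ : χ.Monic) (hχA : χ.map (Int.castRingHom ℝ) = A.charpoly * D.charpoly)
    (hDA : ∀ G : ℤ[X], aeval D G = 0 → aeval A G = 0) {k : ℕ} {f : Fin k → ℤ[X]}
    (h : IsMinpolyFactorization A f) : ∑ i, factorDim A (f i) ≤ χ.natDegree := by
  have hdvd : ∏ i, ((f i).map (Int.castRingHom ℚ)) ^ factorCopies A (f i) ∣
      χ.map (Int.castRingHom ℚ) := by
    refine Finset.prod_dvd_of_coprime ?_ fun i _ => ?_
    · intro i _ j _ hne
      refine IsCoprime.pow (isCoprime_of_irreducible_of_ne (h.2.2.1 i) (h.2.2.1 j)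
        ((h.2.1 i).map _) ((h.2.1 j).map _) fun heq => hne (h.1 ?_))
      exact map_injective _ Int.cast_injective heq
    · rw [← Polynomial.map_pow]
      exact Polynomial.map_dvd _
        (pow_factorCopies_dvd hχ hχA hDA (h.2.1 i) (h.2.2.1 i) (h.dvd_minpoly i))
  have h1 := natDegree_le_of_dvd hdvd (hχ.map _).ne_zero
  rw [hχ.natDegree_map, natDegree_prod_of_monic _ _ fun i _ => ((h.2.1 i).map _).pow _] at h1
  refine le_trans (le_of_eq (Finset.sum_congr rfl fun i _ => ?_)) h1
  rw [factorDim_eq, ((h.2.1 i).map _).natDegree_pow, (h.2.1 i).natDegree_map]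

end CutProject

namespace CutProject

open Polynomial Matrix

variable {n m : ℕ} {A : Matrix (Fin n) (Fin n) ℝ}

/-! ### Linear extension of a self-similarity -/

/-- The physical projection as a linear map. -/
def physLin (n m : ℕ) : (Fin (n + m) → ℝ) →ₗ[ℝ] (Fin n → ℝ) where
  toFun := physProj n m
  map_add' _ _ := rfl
  map_smul' _ _ := rfl

/-- The internal projection as a linear map. -/
def intLin (n m : ℕ) : (Fin (n + m) → ℝ) →ₗ[ℝ] (Fin m → ℝ) where
  toFun := intProj n m
  map_add' _ _ := rfl
  map_smul' _ _ := rfl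

theorem norm_intLin_le (x : Fin (n + m) → ℝ) : ‖intLin n m x‖ ≤ ‖x‖ :=
  (pi_norm_le_iff_of_nonneg (norm_nonneg x)).mpr fun _ => norm_le_pi_norm x _

theorem eq_zero_of_projections {x : Fin (n + m) → ℝ} (h1 : physLin n m x = 0)
    (h2 : intLin n m x = 0) : x = 0 := by
  ext i
  refine Fin.addCases (fun i => ?_) (fun i => ?_) i
  exacts [congrFun h1 i, congrFun h2 i]

namespace Scheme

variable (S : Scheme n m)

/-- Lattice points with bounded internal projection are combinations of lattice points with small
internal projection. -/
theorem exists_small_decomposition (hS : S.IsIrreducible) {r : ℝ} (hr : 0 < r) (R : ℝ) :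
    ∃ N : ℕ, ∀ l ∈ S.lattice, ‖intLin n m l‖ ≤ R →
      ∃ l' ∈ S.lattice, ‖intLin n m l'‖ < r ∧ ‖intLin n m (l - N • l')‖ < r := by
  -- `N` makes `R / N < r / 2`. Density then gives `l'` with internal projection within `r / (2 *
  -- N)` of that of `l` divided by `N`; multiplying back by `N` leaves an error of less than `r /
  -- 2`.
  obtain ⟨N, hN⟩ := exists_nat_gt (max 0 (2 * R / r))
  have hN0 : (0 : ℝ) < N := (le_max_left _ _).trans_lt hN
  have hNR : R / N < r / 2 := by
    have := (le_max_right _ _).trans_lt hN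
    rw [div_lt_iff₀ hr] at this
    rw [div_lt_iff₀ hN0]
    linarith
  refine ⟨N, fun l hl hle => ?_⟩
  obtain ⟨_, ⟨l', hl', rfl⟩, hdist⟩ := hS.exists_dist_lt ((N : ℝ)⁻¹ • intLin n m l)
    (show 0 < r / (2 * N) by positivity)
  rw [dist_eq_norm] at hdist
  change ‖(N : ℝ)⁻¹ • intLin n m l - intLin n m l'‖ < _ at hdist
  have h1 : r / (2 * N) ≤ r / 2 := by
    have hN1 : (1 : ℝ) ≤ N := by
      exact_mod_cast Nat.one_le_iff_ne_zero.mpr (by rintro rfl; simp at hN0)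
    gcongr
    linarith
  refine ⟨l', hl', ?_, ?_⟩
  · have h2 : ‖(N : ℝ)⁻¹ • intLin n m l‖ ≤ R / N := by
      rw [norm_smul, norm_inv, Real.norm_natCast, div_eq_inv_mul]
      gcongr
    have h3 := norm_sub_le ((N : ℝ)⁻¹ • intLin n m l) ((N : ℝ)⁻¹ • intLin n m l - intLin n m l')
    rw [sub_sub_cancel] at h3
    linarith
  · have h2 : intLin n m (l - N • l') = (N : ℝ) • ((N : ℝ)⁻¹ • intLin n m l - intLin n m l') := by
      rw [smul_sub, smul_smul, mul_inv_cancel₀ hN0.ne', one_smul, map_sub, map_nsmul,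
        Nat.cast_smul_eq_nsmul]
    rw [h2, norm_smul, Real.norm_natCast]
    calc (N : ℝ) * _ < N * (r / (2 * N)) := by gcongr
      _ = r / 2 := by field_simp
      _ < r := by linarith

theorem exists_ball_subset_window (hS : S.IsIrreducible) {W : Set (Fin m → ℝ)}
    (hW : IsWindow W) :
    ∃ l ∈ S.lattice, ∃ r > 0, Metric.ball (intLin n m l) r ⊆ W := by
  have hne : (interior W).Nonempty := by
    rw [← closure_nonempty_iff, hW.2.1]
    exact hW.2.2
  obtain ⟨_, hx, l, hl, rfl⟩ := hS.inter_open_nonempty _ isOpen_interior hne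
  obtain ⟨r, hr, hball⟩ := Metric.isOpen_iff.mp isOpen_interior _ hx
  exact ⟨l, hl, r, hr, hball.trans interior_subset⟩

/-- A self-similarity of a cut-and-project set acts on the physical projection of the lattice. -/
theorem exists_lattice_lift (hS : S.IsIrreducible) {W : Set (Fin m → ℝ)} (hW : IsWindow W)
    (hA : Set.MapsTo (fun x => A *ᵥ x) (S.cutSet W) (S.cutSet W)) :
    ∀ l ∈ S.lattice, ∃ l' ∈ S.lattice, physLin n m l' = A *ᵥ physLin n m l := by
  obtain ⟨l₀, hl₀, r, hr, hball⟩ := S.exists_ball_subset_window hS hW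
  have h1 : ∀ l ∈ S.lattice, intLin n m l ∈ W →
      ∃ l' ∈ S.lattice, physLin n m l' = A *ᵥ physLin n m l := by
    intro l hl hlW
    obtain ⟨l', hl', -, h⟩ := hA ⟨l, hl, hlW, rfl⟩
    exact ⟨l', hl', h⟩
  -- A lattice point with small internal projection is the difference of `l₀ + l` and `l₀`, both of
  -- which project into the window.
  have h2 : ∀ l ∈ S.lattice, ‖intLin n m l‖ < r →
      ∃ l' ∈ S.lattice, physLin n m l' = A *ᵥ physLin n m l := by
    intro l hl hlr
    obtain ⟨p, hp, hpe⟩ := h1 (l₀ + l) (add_mem hl₀ hl) (hball (by simpa [dist_eq_norm] using hlr))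
    obtain ⟨q, hq, hqe⟩ := h1 l₀ hl₀ (hball (Metric.mem_ball_self hr))
    refine ⟨p - q, sub_mem hp hq, ?_⟩
    rw [map_sub, hpe, hqe, map_add, mulVec_add, add_sub_cancel_left]
  intro l hl
  obtain ⟨N, hN⟩ := S.exists_small_decomposition hS hr ‖intLin n m l‖
  obtain ⟨l', hl', h3, h4⟩ := hN l hl le_rfl
  obtain ⟨p, hp, hpe⟩ := h2 l' hl' h3
  obtain ⟨q, hq, hqe⟩ := h2 _ (sub_mem hl (nsmul_mem hl' N)) h4
  refine ⟨q + N • p, add_mem hq (nsmul_mem hp N), ?_⟩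
  rw [map_add, map_nsmul, hpe, hqe, map_sub, map_nsmul, mulVec_sub]
  have : A *ᵥ (N • physLin n m l') = N • (A *ᵥ physLin n m l') := map_nsmul A.mulVecLin _ _
  rw [this]
  abel

variable {S}

/-- The linear extension of a self-similarity to the whole space leaves the physical space
invariant. -/
theorem intLin_eq_zero_of_extension (hS : S.Generic) {W : Set (Fin m → ℝ)} (hW : IsWindow W)
    (hA : Set.MapsTo (fun x => A *ᵥ x) (S.cutSet W) (S.cutSet W))
    (B : Module.End ℝ (Fin (n + m) → ℝ)) (hBL : ∀ l ∈ S.lattice, B l ∈ S.lattice)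
    (hBA : ∀ x, physLin n m (B x) = A *ᵥ physLin n m x) (x : Fin (n + m) → ℝ)
    (hx : intLin n m x = 0) : intLin n m (B x) = 0 := by
  obtain ⟨l₀, hl₀, r, hr, hball⟩ := S.exists_ball_subset_window hS.2.2 hW
  obtain ⟨K, hK⟩ := isBounded_iff_forall_norm_le.mp hW.1
  have h1 : ∀ l ∈ S.lattice, intLin n m l ∈ W → ‖intLin n m (B l)‖ ≤ K := by
    intro l hl hlW
    obtain ⟨l', hl', hW', h⟩ := hA ⟨l, hl, hlW, rfl⟩
    -- Injectivity of the physical projection identifies `B l` with the lattice point that the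
    -- self-similarity supplies, so its internal projection lies in the bounded window.
    have : B l = l' := hS.1 (hBL l hl) hl' ((hBA l).trans h.symm)
    rw [this]
    exact hK _ hW'
  have h2 : ∀ l ∈ S.lattice, ‖intLin n m l‖ < r → ‖intLin n m (B l)‖ ≤ 2 * K := by
    intro l hl hlr
    have h3 := h1 (l₀ + l) (add_mem hl₀ hl) (hball (by simpa [dist_eq_norm] using hlr))
    have h4 := h1 l₀ hl₀ (hball (Metric.mem_ball_self hr))
    have h5 := norm_sub_le (intLin n m (B (l₀ + l))) (intLin n m (B l₀))
    rw [← map_sub, ← map_sub, add_sub_cancel_left] at h5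
    linarith
  obtain ⟨b, hb⟩ := S.exists_basis
  obtain ⟨N, hN⟩ := S.exists_small_decomposition hS.2.2 hr (∑ i, ‖b i‖)
  have h3 : ∀ l ∈ S.lattice, ‖intLin n m l‖ ≤ ∑ i, ‖b i‖ →
      ‖intLin n m (B l)‖ ≤ 2 * K + N * (2 * K) := by
    intro l hl hle
    obtain ⟨l', hl', h4, h5⟩ := hN l hl hle
    have h6 := h2 _ (sub_mem hl (nsmul_mem hl' N)) h5
    have h7 : intLin n m (B l) = intLin n m (B (l - N • l')) + (N : ℝ) • intLin n m (B l') := by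
      rw [Nat.cast_smul_eq_nsmul, map_sub, map_nsmul, map_sub, map_nsmul, sub_add_cancel]
    rw [h7]
    refine (norm_add_le _ _).trans (add_le_add h6 ?_)
    rw [norm_smul, Real.norm_natCast]
    exact mul_le_mul_of_nonneg_left (h2 l' hl' h4) (Nat.cast_nonneg N)
  let F := (intLin n m ∘ₗ B).toContinuousLinearMap
  -- The point `t • x` has a lattice point within `∑ i, ‖b i‖`, whose internal projection is bounded
  -- independently of `t`. So the internal projection of `B (t • x)` stays bounded while growing
  -- linearly in `t`, which forces it to vanish.
  have h4 : ∀ t : ℕ, t * ‖intLin n m (B x)‖ ≤ 2 * K + N * (2 * K) + ‖F‖ * ∑ i, ‖b i‖ := by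
    intro t
    let l : Fin (n + m) → ℝ := ZSpan.floor b ((t : ℝ) • x)
    have hl : l ∈ S.lattice := by
      rw [hb]
      exact (ZSpan.floor b ((t : ℝ) • x)).2
    have hfr : ‖(t : ℝ) • x - l‖ ≤ ∑ i, ‖b i‖ := ZSpan.norm_fract_le b ((t : ℝ) • x)
    have h5 : ‖intLin n m l‖ ≤ ∑ i, ‖b i‖ := by
      have h6 := (norm_intLin_le ((t : ℝ) • x - l)).trans hfr
      rwa [map_sub, map_smul, hx, smul_zero, zero_sub, norm_neg] at h6
    have h6 : ‖intLin n m (B ((t : ℝ) • x - l))‖ ≤ ‖F‖ * ∑ i, ‖b i‖ :=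
      (F.le_opNorm _).trans (mul_le_mul_of_nonneg_left hfr (norm_nonneg _))
    have h7 : (t : ℝ) • intLin n m (B x) = intLin n m (B l) + intLin n m (B ((t : ℝ) • x - l)) := by
      rw [← map_add, ← map_add, add_sub_cancel, map_smul, map_smul]
    rw [← Real.norm_natCast, ← norm_smul, h7]
    exact (norm_add_le _ _).trans (add_le_add (h3 l hl h5) h6)
  by_contra hne
  have hpos : 0 < ‖intLin n m (B x)‖ := norm_pos_iff.mpr hne
  obtain ⟨t, ht⟩ := exists_nat_gt
    ((2 * K + N * (2 * K) + ‖F‖ * ∑ i, ‖b i‖) / ‖intLin n m (B x)‖)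
  rw [div_lt_iff₀ hpos] at ht
  exact absurd (h4 t) (not_le.mpr ht)

end Scheme

/-! ### The characteristic polynomial of the linear extension -/

theorem aeval_intertwines {E E' : Type*} [AddCommGroup E] [Module ℝ E] [AddCommGroup E']
    [Module ℝ E'] (π : E →ₗ[ℝ] E') (B : Module.End ℝ E) (C : Module.End ℝ E')
    (h : ∀ x, π (B x) = C (π x)) (G : ℤ[X]) (x : E) : π (aeval B G x) = aeval C G (π x) := by
  induction G using Polynomial.induction_on' generalizing x with
  | add p q hp hq => simp [hp, hq]
  | monomial e a =>
    have h1 : ∀ (e : ℕ) x, π ((B ^ e) x) = (C ^ e) (π x) := by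
      intro e
      induction e with
      | zero => simp
      | succ e ih => intro x; rw [pow_succ, pow_succ, Module.End.mul_apply, ih, h]; rfl
    simp [aeval_monomial, h1]

theorem aeval_mem_of_invariant {E : Type*} [AddCommGroup E] [Module ℝ E] {L : Submodule ℤ E}
    (B : Module.End ℝ E) (hB : ∀ l ∈ L, B l ∈ L) (G : ℤ[X]) :
    ∀ l ∈ L, aeval B G l ∈ L := by
  induction G using Polynomial.induction_on' with
  | add p q hp hq =>
    intro l hl
    rw [map_add, LinearMap.add_apply]
    exact add_mem (hp l hl) (hq l hl)
  | monomial e a =>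
    intro l hl
    have h1 : (B ^ e) l ∈ L := by
      induction e with
      | zero => simpa using hl
      | succ e ih => rw [pow_succ', Module.End.mul_apply]; exact hB _ ih
    have h2 : aeval B (monomial e a) l = a • (B ^ e) l := by simp [aeval_monomial]
    rw [h2]
    exact L.smul_mem a h1

/-- The characteristic polynomial of the linear extension of a self-similarity. -/
theorem exists_charpoly_factorization {S : Scheme n m} (hS : S.Generic) {W : Set (Fin m → ℝ)}
    (hW : IsWindow W) (hA : Set.MapsTo (fun x => A *ᵥ x) (S.cutSet W) (S.cutSet W)) :
    ∃ (χ : ℤ[X]) (D : Matrix (Fin m) (Fin m) ℝ), χ.Monic ∧ χ.natDegree = n + m ∧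
      χ.map (Int.castRingHom ℝ) = A.charpoly * D.charpoly ∧
      ∀ G : ℤ[X], aeval D G = 0 → aeval A G = 0 := by
  obtain ⟨b, hb⟩ := S.exists_basis
  have hbL : ∀ i, b i ∈ S.lattice := fun i => by
    rw [hb]
    exact Submodule.subset_span ⟨i, rfl⟩
  choose g hgL hgA using fun i => S.exists_lattice_lift hS.2.2 hW hA (b i) (hbL i)
  let B : Module.End ℝ (Fin (n + m) → ℝ) := b.constr ℝ g
  have hBb : ∀ i, B (b i) = g i := fun i => b.constr_basis ℝ g i
  have hBL : ∀ l ∈ S.lattice, B l ∈ S.lattice := by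
    intro l hl
    rw [hb] at hl
    induction hl using Submodule.span_induction with
    | mem x hx =>
      obtain ⟨i, rfl⟩ := hx
      rw [hBb]
      exact hgL i
    | zero => simp
    | add x y _ _ hx hy => rw [map_add]; exact add_mem hx hy
    | smul a x _ hx => rw [map_zsmul]; exact S.lattice.smul_mem a hx
  have hBA : ∀ x, physLin n m (B x) = A.mulVecLin (physLin n m x) := by
    have : physLin n m ∘ₗ B = A.mulVecLin ∘ₗ physLin n m :=
      b.ext fun i => by simp [hBb, hgA]
    exact fun x => LinearMap.congr_fun this x
  let J := joinProj (LinearMap.fst ℝ (Fin n → ℝ) (Fin m → ℝ)) (LinearMap.snd ℝ _ _)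
  have hJp : ∀ y, physLin n m (J y) = y.1 := fun y => physProj_joinProj _ _ y
  have hJi : ∀ y, intLin n m (J y) = y.2 := fun y => intProj_joinProj _ _ y
  let D : Matrix (Fin m) (Fin m) ℝ :=
    LinearMap.toMatrix' (intLin n m ∘ₗ B ∘ₗ J ∘ₗ LinearMap.inr ℝ (Fin n → ℝ) (Fin m → ℝ))
  -- `x` minus the point with the same internal and zero physical projection lies in the physical
  -- space, which `B` preserves.
  have hBD : ∀ x, intLin n m (B x) = D.mulVecLin (intLin n m x) := by
    intro x
    rw [← toLin'_apply', toLin'_toMatrix', ← sub_eq_zero, LinearMap.comp_apply,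
      LinearMap.comp_apply, ← map_sub, ← map_sub]
    refine Scheme.intLin_eq_zero_of_extension hS hW hA B hBL hBA _ ?_
    rw [map_sub, LinearMap.comp_apply, hJi]
    simp
  let e : (Fin (n + m) → ℝ) ≃ₗ[ℝ] (Fin n → ℝ) × (Fin m → ℝ) :=
    LinearEquiv.ofBijective ((physLin n m).prod (intLin n m)) ⟨by
      rw [← LinearMap.ker_eq_bot, LinearMap.ker_eq_bot']
      exact fun x hx => eq_zero_of_projections (congrArg Prod.fst hx) (congrArg Prod.snd hx),
      fun y => ⟨J y, Prod.ext (hJp y) (hJi y)⟩⟩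
  have hchar : B.charpoly = A.charpoly * D.charpoly := by
    have h1 : e.conj B = A.mulVecLin.prodMap D.mulVecLin := by
      refine LinearMap.ext fun y => ?_
      obtain ⟨x, rfl⟩ := e.surjective y
      rw [LinearEquiv.conj_apply_apply, e.symm_apply_apply]
      exact Prod.ext (hBA x) (hBD x)
    rw [← e.charpoly_conj, h1, LinearMap.charpoly_prodMap, ← toLin'_apply', ← toLin'_apply',
      charpoly_toLin', charpoly_toLin']
  -- `B` preserves the lattice, so its matrix in a lattice basis is integral.
  have hint : ∀ i j, ∃ z : ℤ, (z : ℝ) = LinearMap.toMatrix b b B i j := by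
    intro i j
    rw [LinearMap.toMatrix_apply]
    have := hBL _ (hbL j)
    rw [hb, b.mem_span_iff_repr_mem ℤ] at this
    exact this i
  choose M hM using hint
  have hMB : (Matrix.of M).map (Int.castRingHom ℝ) = LinearMap.toMatrix b b B := by
    ext i j
    exact hM i j
  refine ⟨(Matrix.of M).charpoly, D, charpoly_monic _, ?_, ?_, fun G hG => ?_⟩
  · rw [charpoly_natDegree_eq_dim, Fintype.card_fin]
  · rw [← charpoly_map, hMB, LinearMap.charpoly_toMatrix, hchar]
  · have hlin : ∀ {d : ℕ} (C : Matrix (Fin d) (Fin d) ℝ),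
        aeval C.mulVecLin G = (aeval C G).mulVecLin :=
      fun C => aeval_algHom_apply ((toLinAlgEquiv' (R := ℝ)).toAlgHom.restrictScalars ℤ) C G
    -- If `G` annihilates `D`, then `G(B)` sends lattice points to lattice points with zero internal
    -- projection, and aperiodicity makes these zero.
    have h0 : ∀ l ∈ S.lattice, aeval B G l = 0 := by
      intro l hl
      refine hS.2.1 (aeval_mem_of_invariant B hBL G l hl) S.lattice.zero_mem ?_
      change intLin n m (aeval B G l) = intLin n m 0
      rw [aeval_intertwines _ B _ hBD, hlin, hG, map_zero]
      simp
    have hz : aeval B G = 0 := b.ext fun i => by simpa using h0 _ (hbL i)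
    have h1 : (aeval A G).mulVecLin = 0 := by
      refine LinearMap.ext fun y => ?_
      have h2 := aeval_intertwines (physLin n m) B _ hBA G (J (y, 0))
      rw [hz, hJp, hlin] at h2
      simpa using h2.symm
    exact (LinearEquiv.map_eq_zero_iff (toLin' (R := ℝ))).mp h1

theorem sum_factorDim_le {s : ℕ} (hs : AdmitsSelfSimilarSet A s) {k : ℕ} {f : Fin k → ℤ[X]}
    (h : IsMinpolyFactorization A f) : ∑ i, factorDim A (f i) ≤ s := by
  obtain ⟨m, rfl, S, hS, W, hW, hA⟩ := hs
  obtain ⟨χ, D, hχ, hdeg, hχA, hDA⟩ := exists_charpoly_factorization hS hW hA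
  rw [← hdeg]
  exact sum_factorDim_le_natDegree hχ hχA hDA h

end CutProject

theorem mainTheorem4 (n : ℕ) (hn : 1 ≤ n) (A : Matrix (Fin n) (Fin n) ℝ)
    (hA : A.det ≠ 0) (hdiag : CutProject.DiagonalizableOverC A)
    (hP : CutProject.PropertyP A) :
    (∃ (k : ℕ) (f : Fin k → Polynomial ℤ), CutProject.IsMinpolyFactorization A f) ∧
    ∀ (k : ℕ) (f : Fin k → Polynomial ℤ), CutProject.IsMinpolyFactorization A f →
      IsLeast {s : ℕ | CutProject.AdmitsSelfSimilarSet A s}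
        (∑ i, CutProject.factorDim A (f i)) := by
  refine ⟨CutProject.exists_minpoly_factorization hdiag hP.1, fun k f h =>
    ⟨?_, fun s hs => CutProject.sum_factorDim_le hs h⟩⟩
  -- As `1 ≤ n`, the matrix has an eigenvalue, and it is a root of some factor.
  have hk : 0 < k := by
    obtain ⟨u, -⟩ := CutProject.exists_eigenbasis A hdiag
    have : Nonempty (Fin n) := ⟨⟨0, hn⟩⟩
    obtain ⟨x⟩ := u.index_nonempty
    obtain ⟨i, -⟩ := h.exists_root hdiag (Nat.zero_lt_of_lt x.2)
    exact i.pos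
  rw [Set.mem_ofPred_eq, Finset.sum_congr rfl fun i _ => CutProject.factorDim_eq A (f i)]
  exact (CutProject.isModelData_of_propertyP hA hdiag hP h).admitsSelfSimilarSet hdiag hn hk
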